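/- **Theorem 3 (PEPS zero testing is NP-hard).** For integers $m,n,d,D\ge 1$, an open-boundary $m\times n$ square-lattice PEPS with physical dimension $d$ and bond dimension $D$ is given by one tensor $A_{(k,l)}^{u\,d'\,l'\,r}(s)\in\mathbb{C}$ per site $(k,l)$, where $s\in\{1,\dots,d\}$ and each of the virtual indices (up, down, left, right) ranges over $\{1,\dots,D\}$, except that legs sticking out of the lattice have dimension $1$. It generates the vector $$\sum_{s_{11},\dots,s_{mn}=1}^d \mathcal{C}[A_{(1,1)}(s_{11}),\dots,A_{(m,n)}(s_{mn})]\,|s_{11}\dots s_{mn}\rangle\in(\mathbb{C}^d)^{\otimes mn},$$ where $\mathcal{C}$ is the contraction of neighbouring virtual indices. PEPS zero testing is the problem of deciding, given $m,n,d,D$ and all the tensors explicitly, with entries in $\mathbb{Q}+i\mathbb{Q}$, whether this vector is different from zero. PEPS zero testing is NP-hard under polynomial-time many-one reductions, even when restricted to PEPS that are translation invariant in the bulk. That is, for every language $L\in\mathsf{NP}$ over a finite alphabet there is a map $w\mapsto P_w$, computable in deterministic polynomial time, from words to PEPS, such that for every word $w$ the tensors of $P_w$ at all sites having four neighbours are equal,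 and $w\in L$ if and only if the vector generated by $P_w$ is non-zero. -/

import Mathlib

/-! ### Nondeterministic Turing machines and the class NP -/

/-- The possible moves of the head of a Turing machine. -/
inductive HeadMove where
  | left
  | stay
  | right

/-- The displacement of the head caused by a move. -/
def HeadMove.toInt : HeadMove → ℤ
  | .left => -1
  | .stay => 0
  | .right => 1

/-- A nondeterministic Turing machine with one two-way infinite tape, taking words over `α` as
input: finitely many tape symbols with a blank, finitely many states, and a finite table of
instructions `(q, s, q', s', M)`. The input alphabet sits among the non-blank tape symbols. -/
structure NTM (α : Type) where
  /-- tape symbols -/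
  Symb : Type
  /-- states of the head -/
  State : Type
  [symbFintype : Fintype Symb]
  [stateFintype : Fintype State]
  /-- the blank symbol -/
  blank : Symb
  /-- the tape symbol of an input letter -/
  letter : α → Symb
  letter_injective : Function.Injective letter
  letter_ne_blank : ∀ a, letter a ≠ blank
  /-- the initial state -/
  start : State
  /-- the accepting state -/
  accept : State
  /-- the instructions -/
  program : Set (State × Symb × State × Symb × HeadMove)

namespace NTM

variable {α : Type}

/-- An instantaneous description: state, head position and tape content. -/
structure Config (M : NTM α) where
  /-- state of the head -/
  state : M.State
  /-- position of the head -/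
  head : ℤ
  /-- content of the tape -/
  tape : ℤ → M.Symb

/-- The input is written on the cells `0, 1, …`, all other cells are blank, and the head is on
cell `0` in the initial state. -/
def init (M : NTM α) (w : List α) : M.Config where
  state := M.start
  head := 0
  tape
    | .ofNat i => (w[i]?.map M.letter).getD M.blank
    | .negSucc _ => M.blank

/-- One step of a computation, according to some applicable instruction. -/
def Step (M : NTM α) (c c' : M.Config) : Prop :=
  ∃ q s mv, (c.state, c.tape c.head, q, s, mv) ∈ M.program ∧
    c' = ⟨q, c.head + mv.toInt, Function.update c.tape c.head s⟩

/-- `M.StepsTo t c c'`: some computation of exactly `t` steps leads from `c` to `c'`. -/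
def StepsTo (M : NTM α) : ℕ → M.Config → M.Config → Prop
  | 0, c, c' => c = c'
  | t + 1, c, c' => ∃ c'', M.Step c c'' ∧ M.StepsTo t c'' c'

/-- No instruction is applicable. -/
def Halted (M : NTM α) (c : M.Config) : Prop :=
  ∀ c', ¬ M.Step c c'

/-- Some computation on input `w` halts after exactly `t` steps, in the accepting state. -/
def AcceptsIn (M : NTM α) (w : List α) (t : ℕ) : Prop :=
  ∃ c, M.StepsTo t (M.init w) c ∧ M.Halted c ∧ c.state = M.accept

end NTM

/-- A language is in NP if some nondeterministic Turing machine accepts exactly its words, and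
accepts each of them by a computation of polynomially many steps. -/
def InNP {α : Type} (L : Language α) : Prop :=
  ∃ M : NTM α, (∀ w, w ∈ L ↔ ∃ t, M.AcceptsIn w t) ∧
    ∃ p : Polynomial ℕ, ∀ w ∈ L, ∃ t ≤ p.eval w.length, M.AcceptsIn w t

/-- NP-hardness, under polynomial-time many-one reductions, of the problem of deciding whether an
instance (given to a machine through `enc`) lies in `Yes`, already on the instances in `C`: every
language in NP is reduced to the problem by a map with values in `C`, computed in polynomial time
by a deterministic Turing machine. For `C = Set.univ` this is NP-hardness of the problem; any `C`
makes it stronger. -/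
def IsNPHardOn {P Γ : Type} (enc : P → List Γ) (C Yes : Set P) : Prop :=
  ∀ (α : Type) [Finite α] (L : Language α), InNP L →
    ∃ f : List α → P,
      Nonempty (Turing.TM2ComputableInPolyTime (id : List α → List α) enc f) ∧
        ∀ w, f w ∈ C ∧ (w ∈ L ↔ f w ∈ Yes)

/-! ### Projected entangled pair states with open boundary conditions -/

/-- The dimension of the virtual legs on the `i`-th line of links, along a direction in which the
lattice has `m` sites: links `0` and `m` stick out of the lattice and are one-dimensional, the
others carry the bond dimension `D`. -/
def linkDim (m D : ℕ) (i : Fin (m + 1)) : ℕ :=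
  if i = 0 ∨ i = Fin.last m then 1 else D

/-- One `(4+1)`-index tensor for each site `(k, l)` of an `m × n` lattice, with physical dimension
`d` and bond dimension `D`. The indices are, in order: up, down, left, right, physical. -/
abbrev SiteTensors (R : Type) (m n d D : ℕ) : Type :=
  ∀ (k : Fin m) (l : Fin n),
    Fin (linkDim m D k.castSucc) → Fin (linkDim m D k.succ) →
      Fin (linkDim n D l.castSucc) → Fin (linkDim n D l.succ) → Fin d → R

/-- The (unnormalised) vector generated by the tensors, in the product basis: the amplitude on `s`
is the contraction of the tensors `A k l (s k l)`, the sum over all the virtual indices `v i l` of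
vertical links and `h k j` of horizontal links. -/
noncomputable def SiteTensors.state {m n d D : ℕ} (A : SiteTensors ℂ m n d D) :
    (Fin m → Fin n → Fin d) → ℂ := fun s =>
  ∑ v : (∀ i : Fin (m + 1), Fin n → Fin (linkDim m D i)),
    ∑ h : (Fin m → ∀ j : Fin (n + 1), Fin (linkDim n D j)),
      ∏ k : Fin m, ∏ l : Fin n,
        A k l (v k.castSucc l) (v k.succ l) (h k l.castSucc) (h k l.succ) (s k l)

/-- A finite description of a PEPS on a square lattice with open boundary conditions: its sizes and
all the entries of its tensors. The entry `(a, b)` is the complex number `a + b i`. -/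
structure PEPS where
  /-- number of rows -/
  m : ℕ
  /-- number of columns -/
  n : ℕ
  /-- physical dimension -/
  d : ℕ
  /-- bond dimension -/
  D : ℕ
  m_pos : 0 < m
  n_pos : 0 < n
  d_pos : 0 < d
  D_pos : 0 < D
  /-- the tensors -/
  tensor : SiteTensors (ℚ × ℚ) m n d D

namespace PEPS

/-- The vector obtained by contracting the PEPS. -/
noncomputable def state (P : PEPS) : (Fin P.m → Fin P.n → Fin P.d) → ℂ :=
  SiteTensors.state fun k l u d' l' r s =>
    (⟨(P.tensor k l u d' l' r s).1, (P.tensor k l u d' l' r s).2⟩ : ℂ)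

/-- The site `(k, l)` is in the bulk: it has a neighbour in each of the four directions. -/
def IsBulk (P : PEPS) (k : Fin P.m) (l : Fin P.n) : Prop :=
  0 < k.val ∧ k.val + 1 < P.m ∧ 0 < l.val ∧ l.val + 1 < P.n

/-- Translation invariance in the bulk: the tensors at any two bulk sites have the same entries. -/
def IsBulkHomogeneous (P : PEPS) : Prop :=
  ∀ k l k' l', P.IsBulk k l → P.IsBulk k' l' →
    ∀ u d' a b u' d'' a' b' s,
      u.val = u'.val → d'.val = d''.val → a.val = a'.val → b.val = b'.val →
        P.tensor k l u d' a b s = P.tensor k' l' u' d'' a' b' s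

open Computability

/-- A size, in unary. -/
def encodeSize (n : ℕ) : List Γ' :=
  List.replicate n (Γ'.bit true) ++ [Γ'.comma]

/-- A natural number, in binary. -/
def encodeBinary (n : ℕ) : List Γ' :=
  (encodeNat n).map Γ'.bit ++ [Γ'.comma]

/-- A rational number: the sign, and the numerator and denominator in binary. -/
def encodeRat (q : ℚ) : List Γ' :=
  Γ'.bit (decide (q.num < 0)) :: (encodeBinary q.num.natAbs ++ encodeBinary q.den)

/-- A complex number with rational parts. -/
def encodeEntry (z : ℚ × ℚ) : List Γ' :=
  encodeRat z.1 ++ encodeRat z.2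

/-- A family indexed by `Fin n`, by concatenation. -/
def encodeFamily {n : ℕ} {β : Fin n → Type} (e : ∀ i, β i → List Γ') (f : ∀ i, β i) : List Γ' :=
  (List.finRange n).flatMap fun i => e i (f i)

/-- All the entries of all the tensors, site by site in reading order, and in lexicographic order
of the indices at each site. -/
def encodeTensors {m n d D : ℕ} (A : SiteTensors (ℚ × ℚ) m n d D) : List Γ' :=
  encodeFamily (fun _ => encodeFamily fun _ => encodeFamily fun _ => encodeFamily fun _ =>
    encodeFamily fun _ => encodeFamily fun _ => encodeFamily fun _ => encodeEntry) A

/-- The description of a PEPS as a word over a finite alphabet. The sizes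
may be in unary, since they are at most the number of entries of the tensors (for the bond
dimension, as soon as there is a bond). -/
def encode (P : PEPS) : List Γ' :=
  encodeSize P.m ++ (encodeSize P.n ++ (encodeSize P.d ++ (encodeSize P.D ++
    encodeTensors P.tensor)))

/-- A code in which no code word is followed ambiguously. -/
def SelfDelimiting {β : Type} (e : β → List Γ') : Prop :=
  ∀ a b r s, e a ++ r = e b ++ s → a = b ∧ r = s

theorem selfDelimiting_map {β : Type} {g : β → List Bool} (hg : Function.Injective g) :
    SelfDelimiting fun x => (g x).map Γ'.bit ++ [Γ'.comma] := by
  have key : ∀ (x y : List Bool) (r s : List Γ'),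
      (x.map Γ'.bit ++ [Γ'.comma]) ++ r = (y.map Γ'.bit ++ [Γ'.comma]) ++ s → x = y ∧ r = s := by
    intro x
    induction x with
    | nil => intro y r s h; cases y <;> simp_all
    | cons a x ih =>
      intro y r s h
      cases y with
      | nil => simp at h
      | cons b y =>
        simp only [List.map_cons, List.cons_append, List.cons.injEq, Γ'.bit.injEq] at h
        obtain ⟨h1, h2⟩ := ih y r s h.2
        exact ⟨by rw [h.1, h1], h2⟩
  intro a b r s h
  obtain ⟨h1, h2⟩ := key _ _ _ _ h
  exact ⟨hg h1, h2⟩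

theorem selfDelimiting_encodeSize : SelfDelimiting encodeSize := by
  have h := selfDelimiting_map (g := fun n => List.replicate n true)
    (fun a b hab => by simpa using congrArg List.length hab)
  simp only [List.map_replicate] at h
  exact h

theorem selfDelimiting_encodeBinary : SelfDelimiting encodeBinary :=
  selfDelimiting_map encodingNatBool.encode_injective

theorem selfDelimiting_encodeRat : SelfDelimiting encodeRat := by
  intro a b r s h
  simp only [encodeRat, List.cons_append, List.append_assoc, List.cons.injEq, Γ'.bit.injEq] at h
  obtain ⟨h0, h⟩ := h
  obtain ⟨h1, h⟩ := selfDelimiting_encodeBinary _ _ _ _ h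
  obtain ⟨h2, h⟩ := selfDelimiting_encodeBinary _ _ _ _ h
  rw [decide_eq_decide] at h0
  exact ⟨Rat.ext (by omega) h2, h⟩

theorem selfDelimiting_encodeEntry : SelfDelimiting encodeEntry := by
  intro a b r s h
  simp only [encodeEntry, List.append_assoc] at h
  obtain ⟨h1, h⟩ := selfDelimiting_encodeRat _ _ _ _ h
  obtain ⟨h2, h⟩ := selfDelimiting_encodeRat _ _ _ _ h
  exact ⟨Prod.ext h1 h2, h⟩

theorem selfDelimiting_encodeFamily {n : ℕ} {β : Fin n → Type} {e : ∀ i, β i → List Γ'}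
    (he : ∀ i, SelfDelimiting (e i)) : SelfDelimiting (encodeFamily e) := by
  have key : ∀ (I : List (Fin n)) (f g : ∀ i, β i) (r s : List Γ'),
      (I.flatMap fun i => e i (f i)) ++ r = (I.flatMap fun i => e i (g i)) ++ s →
        (∀ i ∈ I, f i = g i) ∧ r = s := by
    intro I f g
    induction I with
    | nil => intro r s h; simpa using h
    | cons i I ih =>
      intro r s h
      simp only [List.flatMap_cons, List.append_assoc] at h
      obtain ⟨h1, h⟩ := he i _ _ _ _ h
      obtain ⟨h2, h⟩ := ih r s h
      exact ⟨by simpa using ⟨h1, h2⟩, h⟩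
  intro f g r s h
  obtain ⟨h1, h2⟩ := key _ f g r s h
  exact ⟨funext fun i => h1 i (List.mem_finRange i), h2⟩

theorem selfDelimiting_encodeTensors {m n d D : ℕ} :
    SelfDelimiting (encodeTensors (m := m) (n := n) (d := d) (D := D)) :=
  selfDelimiting_encodeFamily fun _ => selfDelimiting_encodeFamily fun _ =>
    selfDelimiting_encodeFamily fun _ => selfDelimiting_encodeFamily fun _ =>
    selfDelimiting_encodeFamily fun _ => selfDelimiting_encodeFamily fun _ =>
    selfDelimiting_encodeFamily fun _ => selfDelimiting_encodeEntry

/-- Different descriptions have different codes. -/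
theorem encode_injective : Function.Injective encode := by
  rintro ⟨m, n, d, D, _, _, _, _, A⟩ ⟨m', n', d', D', _, _, _, _, A'⟩ h
  simp only [encode] at h
  obtain ⟨rfl, h⟩ := selfDelimiting_encodeSize _ _ _ _ h
  obtain ⟨rfl, h⟩ := selfDelimiting_encodeSize _ _ _ _ h
  obtain ⟨rfl, h⟩ := selfDelimiting_encodeSize _ _ _ _ h
  obtain ⟨rfl, h⟩ := selfDelimiting_encodeSize _ _ _ _ h
  obtain ⟨rfl, -⟩ := selfDelimiting_encodeTensors A A' [] [] (by simpa using h)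
  rfl

end PEPS

/-! Take physical dimension one and let each tensor be the 0/1 indicator of a set of tiles, the
virtual indices being the colours of the four sides. The single amplitude is then the number of
tilings. Nothing can cancel, so the state is non-zero exactly when a tiling exists
(`indicator_state_ne_zero_iff`).

The tiles are chosen so that tilings are space-time diagrams of a nondeterministic machine: vertical
links carry tape cells, horizontal links carry the head as it moves between cells. The interior
tiles `BulkTile` depend only on the machine, which gives homogeneity of the bulk. The input enters
only through the first row, the last row tests acceptance, and the end columns keep the head inside.
The crux is `IsRow.step`: a row of tiles below a configuration either witnesses acceptance or
performs one genuine step, because no head can appear from nowhere. Conversely,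
`exists_rows_of_stepsTo` turns an accepting computation into a tiling, using the idle tile after an
early halt. With `N` interior rows and `N` blanks on either side of the input, tilings exist if and
only if the machine accepts within `N` steps (`tableauPEPS_state_ne_zero_iff`). An `N` larger than
the polynomial time bound does no harm, so `N = c * max(|w|, 1) ^ k` is taken.

For a fixed machine the description is a concatenation of words from a finite supply
(`tableauPEPS_encode`). A stack machine can therefore have these words hard-wired, compute `N` in
unary by repeated multiplication, and print the description backwards in polynomial time
(`run_program`, `computable_tableauPEPS`). -/

namespace PEPS

open Computability

/-! ### Tilings as contractions of indicator tensors -/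

/-- The number of values of the `i`-th leg along a direction with `m` sites. -/
def legDim (m D i : ℕ) : ℕ :=
  if i = 0 ∨ i = m then 1 else D

theorem linkDim_eq_legDim (m D : ℕ) (i : Fin (m + 1)) : linkDim m D i = legDim m D i.val := by
  simp only [linkDim, legDim, Fin.ext_iff, Fin.val_zero, Fin.val_last]

open Classical in
/-- The entry of a tensor that is the indicator of a predicate. -/
noncomputable def indicatorEntry (p : Prop) : ℚ × ℚ :=
  (if p then 1 else 0, 0)

/-- The PEPS with physical dimension one whose tensors are the indicators of the tiles admitted by
`T` at each site; `T k l u d a b` says that the tile with sides `u`, `d`, `a`, `b` is admitted at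
site `(k, l)`. -/
noncomputable def ofTiles (m n D : ℕ) (hm : 0 < m) (hn : 0 < n) (hD : 0 < D)
    (T : ℕ → ℕ → ℕ → ℕ → ℕ → ℕ → Prop) : PEPS where
  m := m
  n := n
  d := 1
  D := D
  m_pos := hm
  n_pos := hn
  d_pos := Nat.one_pos
  D_pos := hD
  tensor k l u d a b _ := indicatorEntry (T k l u d a b)

section tiling

variable {m n D : ℕ} {hm : 0 < m} {hn : 0 < n} {hD : 0 < D}
  {T : ℕ → ℕ → ℕ → ℕ → ℕ → ℕ → Prop}

/-- A product of indicators is the indicator of the conjunction, so every amplitude is the cast of a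
natural number counting tilings, and it vanishes only if each summand does. -/
theorem indicator_state_ne_zero_iff {d : ℕ} (hd : 0 < d) {A : SiteTensors ℂ m n d D}
    (hA : ∀ k l u e a b s, A k l u e a b s = (⟨((indicatorEntry (T k l u e a b)).1 : ℚ),
      ((indicatorEntry (T k l u e a b)).2 : ℚ)⟩ : ℂ)) :
    A.state ≠ 0 ↔
    ∃ (v : ∀ i : Fin (m + 1), Fin n → Fin (linkDim m D i))
      (h : Fin m → ∀ j : Fin (n + 1), Fin (linkDim n D j)), ∀ (k : Fin m) (l : Fin n),
      T k l (v k.castSucc l) (v k.succ l) (h k l.castSucc) (h k l.succ) := by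
  classical
  have key : ∀ s, A.state s =
      ((∑ v : (∀ i : Fin (m + 1), Fin n → Fin (linkDim m D i)),
        ∑ h : (Fin m → ∀ j : Fin (n + 1), Fin (linkDim n D j)),
        if ∀ (k : Fin m) (l : Fin n),
          T k l (v k.castSucc l) (v k.succ l) (h k l.castSucc) (h k l.succ)
        then 1 else 0 : ℕ) : ℂ) := by
    intro s
    have e : ∀ p : Prop, (⟨((indicatorEntry p).1 : ℚ), ((indicatorEntry p).2 : ℚ)⟩ : ℂ) =
        if p then 1 else 0 := by
      intro p
      by_cases hp : p <;> simp [indicatorEntry, hp, Complex.ext_iff]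
    simp only [SiteTensors.state, hA, e, Finset.prod_ite_zero, Finset.prod_const_one,
      Nat.cast_sum, Nat.cast_ite, Nat.cast_one, Nat.cast_zero]
    simp only [Finset.mem_univ, forall_const]
  rw [Function.ne_iff]
  simp only [key, Pi.zero_apply, ne_eq, Nat.cast_eq_zero, Finset.sum_eq_zero_iff, Finset.mem_univ,
    forall_const, ite_eq_right_iff, one_ne_zero, imp_false]
  push Not
  -- The count does not involve the physical indices; `hd` is needed only to have some product basis
  -- vector on which to evaluate.
  exact ⟨fun ⟨_, h⟩ => h, fun h => ⟨fun _ _ => ⟨0, hd⟩, h⟩⟩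

/-- Colours become plain natural numbers with bounds, so that the diagrams below need no arithmetic
in dependent `Fin` types. -/
theorem ofTiles_state_ne_zero_iff : (ofTiles m n D hm hn hD T).state ≠ 0 ↔
    ∃ v h : ℕ → ℕ → ℕ, (∀ i ≤ m, ∀ l < n, v i l < legDim m D i) ∧
      (∀ k < m, ∀ j ≤ n, h k j < legDim n D j) ∧
      ∀ k < m, ∀ l < n, T k l (v k l) (v (k + 1) l) (h k l) (h k (l + 1)) := by
  refine (indicator_state_ne_zero_iff (m := m) (n := n) (D := D) (T := T) Nat.one_pos
    fun _ _ _ _ _ _ _ => rfl).trans ?_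
  constructor
  · rintro ⟨v, h, H⟩
    refine ⟨fun i l => if hi : i < m + 1 then if hl : l < n then v ⟨i, hi⟩ ⟨l, hl⟩ else 0 else 0,
      fun k j => if hk : k < m then if hj : j < n + 1 then h ⟨k, hk⟩ ⟨j, hj⟩ else 0 else 0,
      ?_, ?_, ?_⟩
    · intro i hi l hl
      have := (v ⟨i, by omega⟩ ⟨l, hl⟩).isLt.trans_eq (linkDim_eq_legDim ..)
      simpa [Nat.lt_succ_of_le hi, hl] using this
    · intro k hk j hj
      have := (h ⟨k, hk⟩ ⟨j, by omega⟩).isLt.trans_eq (linkDim_eq_legDim ..)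
      simpa [Nat.lt_succ_of_le hj, hk] using this
    · intro k hk l hl
      have := H ⟨k, hk⟩ ⟨l, hl⟩
      simp only [hk, hl, Nat.lt_succ_of_lt hk, Nat.lt_succ_of_lt hl, Nat.add_lt_add_iff_right,
        dite_true]
      exact this
  · rintro ⟨v, h, hv, hh, H⟩
    exact ⟨fun i l => ⟨v i l, by
        rw [linkDim_eq_legDim]; exact hv _ (by omega) _ l.isLt⟩,
      fun k j => ⟨h k j, by rw [linkDim_eq_legDim]; exact hh _ k.isLt _ (by omega)⟩,
      fun k l => H k k.isLt l l.isLt⟩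

theorem flatMap_finRange {β : Type} {n n' : ℕ} (hn : n = n') {f : Fin n → List β}
    {g : ℕ → List β} (h : ∀ i, f i = g i) :
    (List.finRange n).flatMap f = (List.range n').flatMap g := by
  subst hn
  rw [← List.map_coe_finRange_eq_range, List.flatMap_map, funext h]

/-- The code of an indicator tensor with the given leg dimensions. -/
noncomputable def siteWord (a b c e : ℕ) (t : ℕ → ℕ → ℕ → ℕ → Prop) : List Γ' :=
  (List.range a).flatMap fun i => (List.range b).flatMap fun j => (List.range c).flatMap fun p =>
    (List.range e).flatMap fun q => encodeEntry (indicatorEntry (t i j p q))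

theorem ofTiles_encode : (ofTiles m n D hm hn hD T).encode =
    encodeSize m ++ (encodeSize n ++ (encodeSize 1 ++ (encodeSize D ++
      (List.range m).flatMap fun k => (List.range n).flatMap fun l =>
        siteWord (legDim m D k) (legDim m D (k + 1)) (legDim n D l) (legDim n D (l + 1))
          (T k l)))) := by
  simp only [encode, encodeTensors, encodeFamily, ofTiles]
  congr 4
  refine flatMap_finRange rfl fun k => flatMap_finRange rfl fun l =>
    flatMap_finRange (linkDim_eq_legDim ..) fun u => flatMap_finRange (linkDim_eq_legDim ..) fun d =>
    flatMap_finRange (linkDim_eq_legDim ..) fun a => flatMap_finRange (linkDim_eq_legDim ..) fun b =>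
    ?_
  simp only [List.finRange_succ, List.finRange_zero, List.map_nil, List.flatMap_cons,
    List.flatMap_nil, List.append_nil]

end tiling

end PEPS

-- Space-time diagrams of computations

attribute [local instance] NTM.symbFintype NTM.stateFintype

namespace NTM

variable {α : Type} (M : NTM α)

/-- The number of a tape cell with a given symbol, visited by the head in a given state, if any. -/
noncomputable def cellCode (s : M.Symb) (q : Option M.State) : ℕ :=
  Fintype.equivFin (M.Symb × Option M.State) (s, q)

/-- The number of the event that the head, in state `q`, passes a link; to the right for
`(true, q)` and to the left for `(false, q)`. The number `0` stands for no such event. -/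
noncomputable def signalCode (x : Bool × M.State) : ℕ :=
  (Fintype.equivFin (Bool × M.State) x).val + 1

/-- A bound for the numbers of cells and events. -/
noncomputable def bondDim : ℕ :=
  Fintype.card (M.Symb × Option M.State) + Fintype.card (Bool × M.State) + 1

/-- No instruction applies to state `q` and symbol `s`. -/
def Stuck (q : M.State) (s : M.Symb) : Prop :=
  ∀ x, (q, s, x) ∉ M.program

/-- The tiles of the space-time diagrams of computations: the upper and lower sides carry a cell
before and after a step, the left and right sides carry the passage of the head. -/
inductive BulkTile : ℕ → ℕ → ℕ → ℕ → Prop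
  | pass (s) : BulkTile (M.cellCode s none) (M.cellCode s none) 0 0
  | fromLeft (s q) : BulkTile (M.cellCode s none) (M.cellCode s (some q)) (M.signalCode (true, q)) 0
  | fromRight (s q) :
      BulkTile (M.cellCode s none) (M.cellCode s (some q)) 0 (M.signalCode (false, q))
  | idle (s) : M.Stuck M.accept s →
      BulkTile (M.cellCode s (some M.accept)) (M.cellCode s (some M.accept)) 0 0
  | stay (q s q' s') : (q, s, q', s', HeadMove.stay) ∈ M.program →
      BulkTile (M.cellCode s (some q)) (M.cellCode s' (some q')) 0 0
  | moveRight (q s q' s') : (q, s, q', s', HeadMove.right) ∈ M.program →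
      BulkTile (M.cellCode s (some q)) (M.cellCode s' none) 0 (M.signalCode (true, q'))
  | moveLeft (q s q' s') : (q, s, q', s', HeadMove.left) ∈ M.program →
      BulkTile (M.cellCode s (some q)) (M.cellCode s' none) (M.signalCode (false, q')) 0

/-- The cells admitted at the end of an accepting computation. -/
def FinalCell (u : ℕ) : Prop :=
  ∃ s, u = M.cellCode s none ∨ u = M.cellCode s (some M.accept) ∧ M.Stuck M.accept s

variable {M}

theorem cellCode_inj {s s' : M.Symb} {q q' : Option M.State} :
    M.cellCode s q = M.cellCode s' q' ↔ s = s' ∧ q = q' := by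
  simp [cellCode, Fin.val_inj]

theorem signalCode_inj {x y : Bool × M.State} : M.signalCode x = M.signalCode y ↔ x = y := by
  simp [signalCode, Fin.val_inj]

theorem signalCode_ne_zero (x : Bool × M.State) : M.signalCode x ≠ 0 :=
  Nat.succ_ne_zero _

theorem cellCode_lt (s : M.Symb) (q : Option M.State) : M.cellCode s q < M.bondDim := by
  have := (Fintype.equivFin (M.Symb × Option M.State) (s, q)).isLt
  unfold cellCode bondDim
  omega

theorem signalCode_lt (x : Bool × M.State) : M.signalCode x < M.bondDim := by
  have := (Fintype.equivFin (Bool × M.State) x).isLt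
  unfold signalCode bondDim
  omega

/-- Headless tiles only receive the head and never emit it; this is what excludes spurious signals
between two headless cells. -/
theorem BulkTile.of_none {s : M.Symb} {y a b : ℕ} (h : M.BulkTile (M.cellCode s none) y a b) :
    (a = 0 ∧ b = 0 ∧ y = M.cellCode s none) ∨
    (∃ q, a = M.signalCode (true, q) ∧ b = 0 ∧ y = M.cellCode s (some q)) ∨
    (∃ q, a = 0 ∧ b = M.signalCode (false, q) ∧ y = M.cellCode s (some q)) := by
  generalize hu : M.cellCode s none = u at h
  cases h <;> simp_all [cellCode_inj]

theorem BulkTile.of_some {s : M.Symb} {q : M.State} {y a b : ℕ}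
    (h : M.BulkTile (M.cellCode s (some q)) y a b) :
    (q = M.accept ∧ M.Stuck q s ∧ a = 0 ∧ b = 0 ∧ y = M.cellCode s (some q)) ∨
    ∃ q' s', ((q, s, q', s', HeadMove.stay) ∈ M.program ∧ a = 0 ∧ b = 0 ∧
        y = M.cellCode s' (some q')) ∨
      ((q, s, q', s', HeadMove.right) ∈ M.program ∧ a = 0 ∧ b = M.signalCode (true, q') ∧
        y = M.cellCode s' none) ∨
      ((q, s, q', s', HeadMove.left) ∈ M.program ∧ a = M.signalCode (false, q') ∧ b = 0 ∧
        y = M.cellCode s' none) := by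
  generalize hu : M.cellCode s (some q) = u at h
  cases h with
  | pass | fromLeft | fromRight => simp [cellCode_inj] at hu
  | idle s hs =>
    simp only [cellCode_inj, Option.some_inj] at hu
    obtain ⟨rfl, rfl⟩ := hu
    exact .inl ⟨rfl, hs, rfl, rfl, rfl⟩
  | stay _ _ q' s' hp | moveRight _ _ q' s' hp | moveLeft _ _ q' s' hp =>
    simp only [cellCode_inj, Option.some_inj] at hu
    obtain ⟨rfl, rfl⟩ := hu
    exact .inr ⟨q', s', by simp [hp]⟩

theorem halted_iff_stuck {c : M.Config} : M.Halted c ↔ M.Stuck c.state (c.tape c.head) := by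
  constructor
  · rintro h ⟨q, s, mv⟩ hp
    exact h _ ⟨q, s, mv, hp, rfl⟩
  · rintro h c' ⟨q, s, mv, hp, -⟩
    exact h _ hp

/-- The number of the `i`-th cell of a row which begins `N` cells to the left of cell `0`. -/
noncomputable def rowCode (N : ℕ) (c : M.Config) (i : ℕ) : ℕ :=
  M.cellCode (c.tape (i - N)) (if (i : ℤ) - N = c.head then some c.state else none)

theorem rowCode_lt (N : ℕ) (c : M.Config) (i : ℕ) : rowCode N c i < M.bondDim :=
  cellCode_lt _ _

/-- The tiles with upper sides `u`, lower sides `d` and vertical links `a` fit into a row of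
length `C` with no passage of the head at the ends. -/
structure IsRow (C : ℕ) (u d a : ℕ → ℕ) : Prop where
  left : a 0 = 0
  right : a C = 0
  tile : ∀ i < C, M.BulkTile (u i) (d i) (a i) (a (i + 1))

theorem rowCode_of_ne {N i i₀ : ℕ} {c : M.Config} (h₀ : c.head = (i₀ : ℤ) - N) (h : i ≠ i₀) :
    rowCode N c i = M.cellCode (c.tape (i - N)) none := by
  rw [rowCode, if_neg (by omega)]

theorem rowCode_self {N i₀ : ℕ} {c : M.Config} (h₀ : c.head = (i₀ : ℤ) - N) :
    rowCode N c i₀ = M.cellCode (c.tape c.head) (some c.state) := by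
  rw [rowCode, if_pos h₀.symm, h₀]

theorem isRow_idle {N C : ℕ} {c : M.Config} (hc : M.Halted c) (ha : c.state = M.accept) :
    M.IsRow C (rowCode N c) (rowCode N c) fun _ => 0 := by
  refine ⟨rfl, rfl, fun i _ => ?_⟩
  unfold rowCode
  split_ifs with h
  · rw [halted_iff_stuck, ha, ← h] at hc
    rw [ha]
    exact .idle _ hc
  · exact .pass _

theorem tape_step_of_ne {c : M.Config} {N i i₀ : ℕ} {s : M.Symb} (h₀ : c.head = (i₀ : ℤ) - N)
    (h : i ≠ i₀) : Function.update c.tape c.head s ((i : ℤ) - N) = c.tape (i - N) :=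
  Function.update_of_ne (by omega) _ _

/-- At most one link of the row is non-zero: the one that the head crosses. -/
theorem exists_isRow_of_step {N C i₀ i₁ : ℕ} {c c' : M.Config} (h : M.Step c c')
    (h₀ : c.head = (i₀ : ℤ) - N) (h₁ : c'.head = (i₁ : ℤ) - N) (hC : i₀ < C) (hC' : i₁ < C) :
    ∃ a : ℕ → ℕ, M.IsRow C (rowCode N c) (rowCode N c') a ∧ ∀ j, a j < M.bondDim := by
  obtain ⟨q, s, mv, hp, rfl⟩ := h
  have hb : 0 < M.bondDim := Nat.succ_pos _
  have e₀ : Function.update c.tape c.head s ((i₀ : ℤ) - N) = s := by rw [← h₀]; simp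
  cases mv with
  | stay =>
    simp only [HeadMove.toInt, add_zero] at h₁ ⊢
    refine ⟨fun _ => 0, ⟨rfl, rfl, fun i hi => ?_⟩, fun _ => hb⟩
    rcases eq_or_ne i i₀ with rfl | hne
    · rw [rowCode_self h₀, rowCode_self (by exact h₀)]
      simpa using .stay _ _ _ _ hp
    · rw [rowCode_of_ne h₀ hne, rowCode_of_ne (by exact h₀) hne]
      simpa only [tape_step_of_ne h₀ hne] using .pass _
  | right =>
    simp only [HeadMove.toInt] at h₁ ⊢
    obtain rfl : i₁ = i₀ + 1 := by omega
    -- Link `j` is the left side of cell `j`, so a move from `i₀` to `i₀ + 1` crosses link `i₀ + 1`.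
    refine ⟨fun j => if j = i₀ + 1 then M.signalCode (true, q) else 0,
      ⟨rfl, if_neg (by omega), fun i hi => ?_⟩, fun j => ?_⟩
    · rcases eq_or_ne i i₀ with rfl | hne
      · rw [rowCode_self h₀, rowCode_of_ne (by exact h₁) (by omega), if_neg (by omega), if_pos rfl]
        simpa only [e₀] using .moveRight _ _ _ _ hp
      · rw [rowCode_of_ne h₀ hne, if_neg (show i + 1 ≠ i₀ + 1 by omega)]
        rcases eq_or_ne i (i₀ + 1) with rfl | hne'
        · rw [if_pos rfl, rowCode_self (by exact h₁)]
          simp only [h₁, tape_step_of_ne h₀ hne]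
          exact .fromLeft _ _
        · rw [if_neg hne', rowCode_of_ne (by exact h₁) hne']
          simpa only [tape_step_of_ne h₀ hne] using .pass _
    · dsimp only
      split_ifs
      exacts [signalCode_lt _, hb]
  | left =>
    simp only [HeadMove.toInt] at h₁ ⊢
    obtain rfl : i₀ = i₁ + 1 := by omega
    -- The head goes from cell `i₁ + 1` to cell `i₁`, which again crosses link `i₁ + 1`.
    refine ⟨fun j => if j = i₁ + 1 then M.signalCode (false, q) else 0,
      ⟨rfl, if_neg (by omega), fun i hi => ?_⟩, fun j => ?_⟩
    · rcases eq_or_ne i (i₁ + 1) with rfl | hne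
      · rw [rowCode_self h₀, rowCode_of_ne (by exact h₁) (by omega), if_pos rfl, if_neg (by omega)]
        simpa only [e₀] using .moveLeft _ _ _ _ hp
      · rw [rowCode_of_ne h₀ hne, if_neg hne]
        rcases eq_or_ne i i₁ with rfl | hne'
        · rw [if_pos rfl, rowCode_self (by exact h₁)]
          simp only [h₁, tape_step_of_ne h₀ hne]
          exact .fromRight _ _
        · rw [if_neg (by omega), rowCode_of_ne (by exact h₁) hne']
          simpa only [tape_step_of_ne h₀ hne] using .pass _
    · dsimp only
      split_ifs
      exacts [signalCode_lt _, hb]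

/-- All links away from the head vanish, so the tile at the head alone decides what happens: it
idles in a halted accepting configuration, or follows an instruction whose signal, if any, is
received by the neighbouring cell. The zero links at the ends forbid moves out of the row. -/
theorem IsRow.step {N C i₀ : ℕ} {c : M.Config} {y a : ℕ → ℕ}
    (h : M.IsRow C (rowCode N c) y a) (h₀ : c.head = (i₀ : ℤ) - N) (hC : i₀ < C) :
    (M.Halted c ∧ c.state = M.accept) ∨
    ∃ c', M.Step c c' ∧ (∃ i₁ : ℕ, c'.head = (i₁ : ℤ) - N ∧ i₁ < C) ∧
      ∀ i < C, y i = rowCode N c' i := by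
  have other : ∀ i < C, i ≠ i₀ →
      (a i = 0 ∧ a (i + 1) = 0 ∧ y i = M.cellCode (c.tape (i - N)) none) ∨
      (∃ q, a i = M.signalCode (true, q) ∧ a (i + 1) = 0 ∧
        y i = M.cellCode (c.tape (i - N)) (some q)) ∨
      (∃ q, a i = 0 ∧ a (i + 1) = M.signalCode (false, q) ∧
        y i = M.cellCode (c.tape (i - N)) (some q)) := fun i hi hne => by
    have := h.tile i hi
    rw [rowCode_of_ne h₀ hne] at this
    exact this.of_none
  -- A link between two headless cells could be non-zero only as a rightward passage for the cell on
  -- its right and a leftward passage for the cell on its left, which have different codes.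
  have zeroLeft : ∀ i < i₀, a i = 0 := by
    intro i
    induction i with
    | zero => exact fun _ => h.left
    | succ i ih =>
      intro hi
      have := ih (by omega)
      rcases other (i + 1) (by omega) (by omega) with h1 | ⟨q, h1⟩ | ⟨q, h1⟩
      · exact h1.1
      · rcases other i (by omega) (by omega) with h2 | ⟨q', h2⟩ | ⟨q', h2⟩
        · exact h2.2.1
        · exact h2.2.1
        · have := h1.1.symm.trans h2.2.1
          simp [signalCode_inj] at this
      · exact h1.1
  have zeroRight : ∀ r i, i + r = C → i₀ + 1 < i → a i = 0 := by
    intro r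
    induction r with
    | zero => rintro i rfl _; exact h.right
    | succ r ih =>
      intro i hi hi'
      obtain ⟨i, rfl⟩ : ∃ j, i = j + 1 := ⟨i - 1, by omega⟩
      rcases other i (by omega) (by omega) with h1 | ⟨q, h1⟩ | ⟨q, h1⟩
      · exact h1.2.1
      · exact h1.2.1
      · rcases other (i + 1) (by omega) (by omega) with h2 | ⟨q', h2⟩ | ⟨q', h2⟩
        · exact h2.1
        · have := h1.2.1.symm.trans h2.1
          simp [signalCode_inj] at this
        · exact h2.1
  have zeroRight : ∀ i ≤ C, i₀ + 1 < i → a i = 0 := fun i hi => zeroRight (C - i) i (by omega)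
  have pass : ∀ i < C, i ≠ i₀ → a i = 0 → a (i + 1) = 0 →
      y i = M.cellCode (c.tape (i - N)) none := by
    intro i hi hne h1 h2
    rcases other i hi hne with h | ⟨q, h, -⟩ | ⟨q, -, h, -⟩
    · exact h.2.2
    · exact absurd (h.symm.trans h1) (signalCode_ne_zero _)
    · exact absurd (h.symm.trans h2) (signalCode_ne_zero _)
  have head := h.tile i₀ hC
  rw [rowCode_self h₀] at head
  have e₀ : ∀ s, Function.update c.tape c.head s ((i₀ : ℤ) - N) = s := by intro s; rw [← h₀]; simp
  rcases head.of_some with ⟨ha, hs, -⟩ | ⟨q, s, ⟨hp, hl, hr, hy⟩ | ⟨hp, hl, hr, hy⟩ | ⟨hp, hl, hr, hy⟩⟩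
  · exact .inl ⟨halted_iff_stuck.2 hs, ha⟩
  · refine .inr ⟨_, ⟨q, s, _, hp, rfl⟩, ⟨i₀, by simpa [HeadMove.toInt] using h₀, hC⟩,
      fun i hi => ?_⟩
    simp only [HeadMove.toInt, add_zero]
    rcases eq_or_ne i i₀ with rfl | hne
    · rw [rowCode_self (by exact h₀), hy]
      simp
    · rw [rowCode_of_ne (by exact h₀) hne]
      simp only [tape_step_of_ne h₀ hne]
      refine pass i hi hne ?_ ?_
      · rcases Nat.lt_or_ge i i₀ with h1 | h1
        · exact zeroLeft i h1
        · rcases eq_or_ne i (i₀ + 1) with rfl | h2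
          · exact hr
          · exact zeroRight i (by omega) (by omega)
      · rcases Nat.lt_or_ge (i + 1) i₀ with h1 | h1
        · exact zeroLeft _ h1
        · rcases eq_or_ne (i + 1) i₀ with rfl | h2
          · exact hl
          · exact zeroRight _ (by omega) (by omega)
  · have hC' : i₀ + 1 < C := by
      rcases Nat.lt_or_ge (i₀ + 1) C with h1 | h1
      · exact h1
      · obtain rfl : C = i₀ + 1 := by omega
        exact absurd (hr.symm.trans h.right) (signalCode_ne_zero _)
    have h₁ : c.head + HeadMove.toInt .right = ((i₀ + 1 : ℕ) : ℤ) - N := by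
      simp only [HeadMove.toInt]; omega
    refine .inr ⟨_, ⟨q, s, _, hp, rfl⟩, ⟨i₀ + 1, h₁, hC'⟩, fun i hi => ?_⟩
    rcases eq_or_ne i i₀ with rfl | hne
    · rw [rowCode_of_ne (by exact h₁) (by omega)]
      simp only [e₀, hy]
    · rcases eq_or_ne i (i₀ + 1) with rfl | hne'
      · rw [rowCode_self (by exact h₁)]
        simp only [h₁, tape_step_of_ne h₀ hne]
        rcases other _ hi hne with h2 | ⟨q', h2⟩ | ⟨q', h2⟩
        · exact absurd (hr.symm.trans h2.1) (signalCode_ne_zero _)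
        · have := hr.symm.trans h2.1
          simp only [signalCode_inj, Prod.mk.injEq, true_and] at this
          rw [h2.2.2, this]
        · exact absurd (hr.symm.trans h2.1) (signalCode_ne_zero _)
      · rw [rowCode_of_ne (by exact h₁) hne']
        simp only [tape_step_of_ne h₀ hne]
        refine pass i hi hne ?_ ?_
        · rcases Nat.lt_or_ge i i₀ with h1 | h1
          · exact zeroLeft i h1
          · exact zeroRight i (by omega) (by omega)
        · rcases Nat.lt_or_ge (i + 1) i₀ with h1 | h1
          · exact zeroLeft _ h1
          · rcases eq_or_ne (i + 1) i₀ with rfl | h2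
            · exact hl
            · exact zeroRight _ (by omega) (by omega)
  · obtain ⟨i₁, rfl⟩ : ∃ i₁, i₀ = i₁ + 1 := by
      cases i₀ with
      | zero => exact absurd (hl.symm.trans h.left) (signalCode_ne_zero _)
      | succ i => exact ⟨i, rfl⟩
    have h₁ : c.head + HeadMove.toInt .left = (i₁ : ℤ) - N := by
      simp only [HeadMove.toInt]; omega
    refine .inr ⟨_, ⟨q, s, _, hp, rfl⟩, ⟨i₁, h₁, by omega⟩, fun i hi => ?_⟩
    rcases eq_or_ne i (i₁ + 1) with rfl | hne
    · rw [rowCode_of_ne (by exact h₁) (by omega)]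
      simp only [e₀, hy]
    · rcases eq_or_ne i i₁ with rfl | hne'
      · rw [rowCode_self (by exact h₁)]
        simp only [h₁, tape_step_of_ne h₀ hne]
        rcases other _ hi hne with h2 | ⟨q', h2⟩ | ⟨q', h2⟩
        · exact absurd (hl.symm.trans h2.2.1) (signalCode_ne_zero _)
        · exact absurd (hl.symm.trans h2.2.1) (signalCode_ne_zero _)
        · have := hl.symm.trans h2.2.1
          simp only [signalCode_inj, Prod.mk.injEq, true_and] at this
          rw [h2.2.2, this]
      · rw [rowCode_of_ne (by exact h₁) hne']
        simp only [tape_step_of_ne h₀ hne]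
        refine pass i hi hne ?_ ?_
        · rcases Nat.lt_or_ge i (i₁ + 1) with h1 | h1
          · exact zeroLeft i h1
          · rcases eq_or_ne i (i₁ + 1 + 1) with rfl | h2
            · exact hr
            · exact zeroRight i (by omega) (by omega)
        · rcases Nat.lt_or_ge (i + 1) (i₁ + 1) with h1 | h1
          · exact zeroLeft _ h1
          · exact zeroRight _ (by omega) (by omega)

/-- Soundness of the tiling: the diagram is read downwards, one step per row, until the head idles
or the last row is reached. -/
theorem exists_stepsTo_of_rows {N C : ℕ} (r : ℕ) {c : M.Config} {i₀ : ℕ}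
    (h₀ : c.head = (i₀ : ℤ) - N) (hC : i₀ < C) {y a : ℕ → ℕ → ℕ}
    (hy : ∀ i < C, y 0 i = rowCode N c i)
    (hrow : ∀ k < r, M.IsRow C (y k) (y (k + 1)) (a k))
    (hfin : ∀ i < C, M.FinalCell (y r i)) :
    ∃ t ≤ r, ∃ c', M.StepsTo t c c' ∧ M.Halted c' ∧ c'.state = M.accept := by
  induction r generalizing c i₀ y a with
  | zero =>
    refine ⟨0, le_rfl, c, rfl, ?_⟩
    have := hfin i₀ hC
    rw [hy _ hC, rowCode_self h₀] at this
    obtain ⟨s, h | ⟨h, hs⟩⟩ := this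
    · simp [cellCode_inj] at h
    · simp only [cellCode_inj, Option.some_inj] at h
      rw [halted_iff_stuck, h.1, h.2]
      exact ⟨hs, rfl⟩
  | succ r ih =>
    have h1 := hrow 0 (Nat.succ_pos _)
    have h2 : M.IsRow C (rowCode N c) (y 1) (a 0) :=
      ⟨h1.left, h1.right, fun i hi => hy i hi ▸ h1.tile i hi⟩
    rcases h2.step h₀ hC with ⟨hh, ha⟩ | ⟨c', hc', ⟨i₁, h₁, hC'⟩, hy'⟩
    -- An idling head already certifies acceptance; the remaining rows are ignored.
    · exact ⟨0, Nat.zero_le _, c, rfl, hh, ha⟩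
    · obtain ⟨t, ht, c'', hs, hh⟩ := ih (y := fun k => y (k + 1)) (a := fun k => a (k + 1)) h₁ hC'
        hy' (fun k hk => hrow (k + 1) (by omega)) hfin
      exact ⟨t + 1, by omega, c'', ⟨c', hc', hs⟩, hh⟩

/-- Completeness of the tiling. The head starts with at least `r` cells on either side, and each
step consumes at most one cell of this margin and exactly one row, so it stays inside. -/
theorem exists_rows_of_stepsTo {N C : ℕ} (r : ℕ) {t : ℕ} (ht : t ≤ r) {c c' : M.Config} {i₀ : ℕ}
    (h₀ : c.head = (i₀ : ℤ) - N) (hC : i₀ + r < C) (hr : r ≤ i₀) (hs : M.StepsTo t c c')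
    (hh : M.Halted c') (ha : c'.state = M.accept) :
    ∃ y a : ℕ → ℕ → ℕ, (∀ k i, y k i < M.bondDim) ∧ (∀ k j, a k j < M.bondDim) ∧
      (∀ i, y 0 i = rowCode N c i) ∧
      (∀ k < r, M.IsRow C (y k) (y (k + 1)) (a k)) ∧ ∀ i, M.FinalCell (y r i) := by
  induction r generalizing c t i₀ with
  | zero =>
    obtain rfl : t = 0 := by omega
    obtain rfl : c = c' := hs
    refine ⟨fun _ => rowCode N c, fun _ _ => 0, fun _ => rowCode_lt N c,
      fun _ _ => Nat.succ_pos _, fun _ => rfl, fun k hk => absurd hk (Nat.not_lt_zero k),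
      fun i => ?_⟩
    dsimp only [rowCode]
    split_ifs with h
    · rw [halted_iff_stuck, ha, ← h] at hh
      exact ⟨_, .inr ⟨by rw [ha], hh⟩⟩
    · exact ⟨_, .inl rfl⟩
  | succ r ih =>
    obtain ⟨c₁, t₁, ht₁, i₁, h₁, hd, hr₁, hs₁, a₀, hrow, hb⟩ : ∃ c₁ t₁, t₁ ≤ r ∧ ∃ i₁ : ℕ,
        c₁.head = (i₁ : ℤ) - N ∧ i₁ + r < C ∧ r ≤ i₁ ∧ M.StepsTo t₁ c₁ c' ∧
        ∃ a : ℕ → ℕ, M.IsRow C (rowCode N c) (rowCode N c₁) a ∧ ∀ j, a j < M.bondDim := by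
      cases t with
      | zero =>
        obtain rfl : c = c' := hs
        -- The computation has ended before the rows are used up: the row repeats the halted
        -- configuration.
        exact ⟨c, 0, Nat.zero_le _, i₀, h₀, by omega, by omega, rfl, _, isRow_idle hh ha,
          fun _ => Nat.succ_pos _⟩
      | succ t =>
        obtain ⟨c₁, hc₁, hs₁⟩ := hs
        obtain ⟨i₁, h₁, hi₁, hi₁'⟩ : ∃ i₁ : ℕ, c₁.head = (i₁ : ℤ) - N ∧ i₁ ≤ i₀ + 1 ∧
            i₀ ≤ i₁ + 1 := by
          obtain ⟨q, s, mv, -, rfl⟩ := hc₁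
          have : -1 ≤ mv.toInt ∧ mv.toInt ≤ 1 := by cases mv <;> simp [HeadMove.toInt]
          refine ⟨(i₀ + mv.toInt).toNat, ?_, ?_, ?_⟩ <;> (try dsimp only) <;> omega
        exact ⟨c₁, t, by omega, i₁, h₁, by omega, by omega, hs₁,
          exists_isRow_of_step hc₁ h₀ h₁ (by omega) (by omega)⟩
    obtain ⟨y, a, hy, ha', hy₀, hrows, hfin⟩ := ih ht₁ h₁ hd hr₁ hs₁
    refine ⟨fun k => k.casesOn (rowCode N c) y, fun k => k.casesOn a₀ a, ?_, ?_, fun _ => rfl, ?_,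
      hfin⟩
    · rintro (_ | k)
      exacts [rowCode_lt N c, hy k]
    · rintro (_ | k)
      exacts [hb, ha' k]
    · rintro (_ | k) hk
      · have e : y 0 = rowCode N c₁ := funext hy₀
        rw [← e] at hrow
        exact hrow
      · exact hrows k (by omega)

end NTM

/-! ### Assembling the description from fixed words -/

open Computability

/-- The words from which the description of a PEPS is put together whose first row depends on a
list of symbols in `β`, and whose other rows are homogeneous apart from their ends. -/
structure PEPSLayout (β : Type) where
  /-- the physical dimension and the bond dimension -/
  header : List Γ'
  /-- upper left corner -/
  topLeft : List Γ'
  /-- sites of the first row -/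
  top : β → List Γ'
  /-- upper right corner -/
  topRight : List Γ'
  /-- left ends -/
  left : List Γ'
  /-- sites of the bulk -/
  bulk : List Γ'
  /-- right ends -/
  right : List Γ'
  /-- lower left corner -/
  bottomLeft : List Γ'
  /-- sites of the last row -/
  bottom : List Γ'
  /-- lower right corner -/
  bottomRight : List Γ'

namespace PEPSLayout

variable {β : Type} (W : PEPSLayout β)

/-- The description of a first row. -/
def topRow (row : List β) : List Γ' :=
  W.topLeft ++ (row.flatMap W.top ++ W.topRight)

/-- The description of a row in the middle. -/
def bulkRow (row : List β) : List Γ' :=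
  W.left ++ ((row.flatMap fun _ => W.bulk) ++ W.right)

/-- The description of a last row. -/
def bottomRow (row : List β) : List Γ' :=
  W.bottomLeft ++ ((row.flatMap fun _ => W.bottom) ++ W.bottomRight)

/-- The description of a PEPS with `N + 2` rows. -/
def word (N : ℕ) (row : List β) : List Γ' :=
  PEPS.encodeSize (N + 2) ++ (PEPS.encodeSize (row.length + 2) ++ (W.header ++ (W.topRow row ++
    ((List.replicate N (W.bulkRow row)).flatten ++ W.bottomRow row))))

end PEPSLayout

theorem List.flatMap_range_add_two {γ : Type} (n : ℕ) (g : ℕ → List γ) :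
    (List.range (n + 2)).flatMap g =
      g 0 ++ (((List.range n).flatMap fun i => g (i + 1)) ++ g (n + 1)) := by
  rw [List.range_succ, List.range_succ_eq_map]
  simp [List.flatMap_append, List.flatMap_map]

theorem List.flatMap_range_length {β γ : Type} (row : List β) {g : ℕ → List γ} {f : β → List γ}
    (h : ∀ i x, row[i]? = some x → g i = f x) :
    (List.range row.length).flatMap g = row.flatMap f := by
  induction row generalizing g with
  | nil => simp
  | cons x row ih =>
    rw [List.length_cons, List.range_succ_eq_map, List.flatMap_cons, List.flatMap_map,
      List.flatMap_cons, h 0 x rfl, ih]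
    exact fun i y hy => h (i + 1) y hy

theorem List.flatMap_range_const {γ : Type} (n : ℕ) (g : ℕ → List γ) (l : List γ)
    (h : ∀ i < n, g i = l) : (List.range n).flatMap g = (List.replicate n l).flatten := by
  rw [List.flatMap_def]
  congr 1
  refine List.eq_replicate_iff.2 ⟨by simp, fun b hb => ?_⟩
  obtain ⟨i, hi, rfl⟩ := List.mem_map.1 hb
  exact h i (List.mem_range.1 hi)

/-! ### The tableau of an input -/

namespace NTM

variable {α : Type} (M : NTM α)

/-- The input with `N` blanks on both sides; the flag marks the initial position of the head. -/
def inputRow (N : ℕ) (w : List α) : List (Option α × Bool) :=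
  List.replicate N (none, false) ++ ((w.head?, true) :: (w.tail.map fun a => (some a, false)) ++
    List.replicate N (none, false))

/-- The number of a cell of the initial configuration. -/
noncomputable def startCode (x : Option α × Bool) : ℕ :=
  M.cellCode ((x.1.map M.letter).getD M.blank) (if x.2 then some M.start else none)

/-- The tile whose lower side is `c` and whose other sides are `0`. -/
def FixedTile (c u d a b : ℕ) : Prop :=
  u = 0 ∧ d = c ∧ a = 0 ∧ b = 0

/-- The tiles of the last row. -/
def BottomTile (u d a b : ℕ) : Prop :=
  M.FinalCell u ∧ d = 0 ∧ a = 0 ∧ b = 0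

/-- The tiles at site `(k, l)` of the diagram of computations in `N` steps, with the given row of
initial cells. -/
def SiteTile (N : ℕ) (row : List (Option α × Bool)) (k l : ℕ) : ℕ → ℕ → ℕ → ℕ → Prop :=
  if l = 0 ∨ l = row.length + 1 then FixedTile 0
  else if k = 0 then FixedTile ((row[l - 1]?.map M.startCode).getD 0)
  else if k = N + 1 then M.BottomTile
  else M.BulkTile

/-- The PEPS that counts the accepting computations of at most `N` steps on the input `w`. -/
noncomputable def tableauPEPS (N : ℕ) (w : List α) : PEPS :=
  PEPS.ofTiles (N + 2) ((inputRow N w).length + 2) M.bondDim (Nat.succ_pos _) (Nat.succ_pos _)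
    (Nat.succ_pos _) (M.SiteTile N (inputRow N w))

theorem length_inputRow (N : ℕ) (w : List α) :
    (inputRow N w).length = 2 * N + (w.length - 1) + 1 := by
  simp [inputRow]
  omega

variable {M}

theorem siteTile_edge {N k l : ℕ} {row : List (Option α × Bool)}
    (h : l = 0 ∨ l = row.length + 1) : M.SiteTile N row k l = FixedTile 0 :=
  if_pos h

theorem siteTile_top {N i : ℕ} {row : List (Option α × Bool)} {x : Option α × Bool}
    (h : row[i]? = some x) : M.SiteTile N row 0 (i + 1) = FixedTile (M.startCode x) := by
  have := (List.getElem?_eq_some_iff.1 h).1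
  rw [SiteTile, if_neg (by omega), if_pos rfl]
  simp [h]

theorem siteTile_bottom {N i : ℕ} {row : List (Option α × Bool)} (h : i < row.length) :
    M.SiteTile N row (N + 1) (i + 1) = M.BottomTile := by
  rw [SiteTile, if_neg (by omega), if_neg (by omega), if_pos rfl]

theorem siteTile_bulk {N i k : ℕ} {row : List (Option α × Bool)} (h : i < row.length)
    (hk : k < N) : M.SiteTile N row (k + 1) (i + 1) = M.BulkTile := by
  rw [SiteTile, if_neg (by omega), if_neg (by omega), if_neg (by omega)]

theorem init_tape_ofNat (w : List α) (i : ℕ) :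
    (M.init w).tape (Int.ofNat i) = (w[i]?.map M.letter).getD M.blank :=
  rfl

theorem init_tape_negSucc (w : List α) (i : ℕ) : (M.init w).tape (Int.negSucc i) = M.blank :=
  rfl

theorem startCode_inputRow {N : ℕ} {w : List α} {i : ℕ} {x : Option α × Bool}
    (h : (inputRow N w)[i]? = some x) : M.startCode x = rowCode N (M.init w) i := by
  unfold startCode rowCode
  rcases Nat.lt_or_ge i N with hi | hi
  · obtain rfl : (none, false) = x := by
      simpa [inputRow, List.getElem?_append, hi] using h
    obtain ⟨j, hj⟩ : ∃ j, (i : ℤ) - N = Int.negSucc j := ⟨N - i - 1, by omega⟩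
    rw [hj, init_tape_negSucc]
    simp [init]
  · obtain ⟨j, rfl⟩ := Nat.exists_eq_add_of_le hi
    have hj : ((N + j : ℕ) : ℤ) - N = Int.ofNat j := by simp
    rw [hj, init_tape_ofNat]
    have h' : ((w.head?, true) :: (w.tail.map fun a => (some a, false)) ++
        List.replicate N ((none, false) : Option α × Bool))[j]? = some x := by
      simpa [inputRow, List.getElem?_append] using h
    cases j with
    | zero =>
      obtain rfl : (w.head?, true) = x := by simpa using h'
      simp [init, List.head?_eq_getElem?]
    | succ j =>
      simp only [List.cons_append, List.getElem?_cons_succ, List.getElem?_append, List.length_map,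
        List.length_tail, List.getElem?_map, List.getElem?_tail] at h'
      split_ifs at h' with hlt
      · rw [List.getElem?_eq_getElem (by omega)] at h'
        obtain rfl : (some (w[j + 1]'(by omega)), false) = x := by simpa using h'
        have : ¬ ((j : ℤ) + 1 = 0) := by omega
        simp [init, List.getElem?_eq_getElem (show j + 1 < w.length by omega), this]
      · obtain rfl : (none, false) = x := (List.eq_of_mem_replicate (List.mem_of_getElem? h')).symm
        have : ¬ ((j : ℤ) + 1 = 0) := by omega
        simp [init, List.getElem?_eq_none (show w.length ≤ j + 1 by omega), this]

theorem legDim_mid {m D i : ℕ} (h : i < m) : PEPS.legDim (m + 1) D (i + 1) = D :=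
  if_neg (by omega)

theorem legDim_first {m D : ℕ} : PEPS.legDim m D 0 = 1 :=
  if_pos (.inl rfl)

theorem legDim_last {m D : ℕ} : PEPS.legDim m D m = 1 :=
  if_pos (.inr rfl)

theorem tableauPEPS_isBulkHomogeneous (N : ℕ) (w : List α) :
    (M.tableauPEPS N w).IsBulkHomogeneous := by
  have key : ∀ (k : Fin (N + 2)) (l : Fin ((inputRow N w).length + 2)),
      (M.tableauPEPS N w).IsBulk k l → M.SiteTile N (inputRow N w) k l = M.BulkTile := by
    rintro k l ⟨h1, h2, h3, h4⟩
    simp only [tableauPEPS, PEPS.ofTiles] at h2 h4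
    rw [SiteTile, if_neg (by omega), if_neg (by omega), if_neg (by omega)]
  intro k l k' l' h h' u d a b u' d' a' b' s hu hd ha hb
  change PEPS.indicatorEntry (M.SiteTile N (inputRow N w) k l u d a b) =
    PEPS.indicatorEntry (M.SiteTile N (inputRow N w) k' l' u' d' a' b')
  rw [key k l h, key k' l' h', hu, hd, ha, hb]

/-- Row `0` fixes the initial configuration, rows `1` to `N` are the steps, and row `N + 1` tests
the final cells. The end columns only force the outer horizontal links to be zero. -/
theorem tableauPEPS_state_ne_zero_iff (N : ℕ) (w : List α) :
    (M.tableauPEPS N w).state ≠ 0 ↔ ∃ t ≤ N, M.AcceptsIn w t := by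
  refine PEPS.ofTiles_state_ne_zero_iff.trans ?_
  set row := inputRow N w with hrow
  -- The head starts at index `N`, and this leaves `N` cells on its right as well as on its left.
  have hlen : 2 * N < row.length := by rw [hrow, length_inputRow]; omega
  have hD : 0 < M.bondDim := Nat.succ_pos _
  have top : ∀ i < row.length, M.SiteTile N row 0 (i + 1) =
      FixedTile (rowCode N (M.init w) i) := fun i hi => by
    rw [siteTile_top (List.getElem?_eq_getElem hi),
      startCode_inputRow (List.getElem?_eq_getElem hi)]
  have h₀ : (M.init w).head = ((N : ℕ) : ℤ) - N := by simp [init]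
  constructor
  · rintro ⟨v, h, -, -, H⟩
    obtain ⟨t, ht, c, hc⟩ := exists_stepsTo_of_rows N (C := row.length) h₀ (by omega)
      (y := fun k i => v (k + 1) (i + 1)) (a := fun k j => h (k + 1) (j + 1))
      (fun i hi => by
        have := H 0 (by omega) (i + 1) (by omega)
        rw [top i hi] at this
        exact this.2.1)
      (fun k hk => by
        refine ⟨?_, ?_, fun i hi => ?_⟩
        · have := H (k + 1) (by omega) 0 (by omega)
          rw [siteTile_edge (.inl rfl)] at this
          exact this.2.2.2
        · have := H (k + 1) (by omega) (row.length + 1) (by omega)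
          rw [siteTile_edge (.inr rfl)] at this
          exact this.2.2.1
        · have := H (k + 1) (by omega) (i + 1) (by omega)
          rwa [siteTile_bulk hi hk] at this)
      (fun i hi => by
        have := H (N + 1) (by omega) (i + 1) (by omega)
        rw [siteTile_bottom hi] at this
        exact this.1)
    exact ⟨t, ht, c, hc⟩
  · rintro ⟨t, ht, c, hs, hh, ha⟩
    obtain ⟨y, a, hy, ha, hy₀, hrows, hfin⟩ :=
      exists_rows_of_stepsTo (C := row.length) N ht h₀ (by omega) le_rfl hs hh ha
    -- The diagram is shifted by one in both directions to make room for the border; legs sticking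
    -- out, vertical links of the end columns and horizontal links of the first and last rows are
    -- zero.
    refine ⟨fun k l => if k = 0 ∨ k = N + 2 ∨ l = 0 ∨ l = row.length + 1 then 0
        else y (k - 1) (l - 1),
      fun k j => if k = 0 ∨ k = N + 1 ∨ j = 0 ∨ j = row.length + 2 then 0
        else a (k - 1) (j - 1), ?_, ?_, ?_⟩
    · intro i _ l _
      dsimp only
      unfold PEPS.legDim
      split_ifs <;> first | omega | apply hy
    · intro i _ l _
      dsimp only
      unfold PEPS.legDim
      split_ifs <;> first | omega | apply ha
    · intro k hk l hl
      by_cases hle : l = 0 ∨ l = row.length + 1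
      · rw [siteTile_edge hle]
        rcases hle with rfl | rfl
        · refine ⟨by simp, by simp, by simp, ?_⟩
          dsimp only
          by_cases hk' : k = 0 ∨ k = N + 1
          · rw [if_pos (by omega)]
          · rw [if_neg (by omega)]
            exact (hrows (k - 1) (by omega)).left
        · refine ⟨by simp, by simp, ?_, by simp⟩
          dsimp only
          by_cases hk' : k = 0 ∨ k = N + 1
          · rw [if_pos (by omega)]
          · rw [if_neg (by omega)]
            exact (hrows (k - 1) (by omega)).right
      · obtain ⟨i, rfl⟩ : ∃ i, l = i + 1 := ⟨l - 1, by omega⟩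
        have hi : i < row.length := by omega
        rcases Nat.eq_zero_or_pos k with rfl | hk0
        · rw [top i hi]
          refine ⟨by simp, ?_, by simp, by simp⟩
          dsimp only
          rw [if_neg (by omega)]
          exact hy₀ i
        · obtain ⟨k, rfl⟩ : ∃ j, k = j + 1 := ⟨k - 1, by omega⟩
          rcases eq_or_ne k N with rfl | hkN
          · rw [siteTile_bottom hi]
            refine ⟨?_, by simp, by simp, by simp⟩
            dsimp only
            rw [if_neg (by omega)]
            exact hfin i
          · rw [siteTile_bulk hi (by omega)]
            dsimp only
            rw [if_neg (by omega), if_neg (by omega), if_neg (by omega), if_neg (by omega)]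
            exact (hrows k (by omega)).tile i hi

variable (M) in
/-- The words from which the descriptions of the PEPS of a machine are put together. -/
noncomputable def layout : PEPSLayout (Option α × Bool) :=
  let D := M.bondDim
  { header := PEPS.encodeSize 1 ++ PEPS.encodeSize D
    topLeft := PEPS.siteWord 1 D 1 D (FixedTile 0)
    top := fun x => PEPS.siteWord 1 D D D (FixedTile (M.startCode x))
    topRight := PEPS.siteWord 1 D D 1 (FixedTile 0)
    left := PEPS.siteWord D D 1 D (FixedTile 0)
    bulk := PEPS.siteWord D D D D M.BulkTile
    right := PEPS.siteWord D D D 1 (FixedTile 0)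
    bottomLeft := PEPS.siteWord D 1 1 D (FixedTile 0)
    bottom := PEPS.siteWord D 1 D D M.BottomTile
    bottomRight := PEPS.siteWord D 1 D 1 (FixedTile 0) }

/-- Only the position type of a site (corner, edge or bulk) and, in the first row, the cell affect
its word. The words in `M.layout` do not depend on the input, so a machine can have them built in.
-/
theorem tableauPEPS_encode (N : ℕ) (w : List α) :
    (M.tableauPEPS N w).encode = M.layout.word N (inputRow N w) := by
  refine PEPS.ofTiles_encode.trans ?_
  set row := inputRow N w
  have hlen : row.length ≠ 0 := by rw [length_inputRow]; omega
  simp only [PEPSLayout.word, PEPSLayout.topRow, PEPSLayout.bulkRow, PEPSLayout.bottomRow, layout,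
    List.append_assoc]
  congr 4
  have mid : ∀ {n i D : ℕ}, i < n + 1 → PEPS.legDim (n + 2) D (i + 1) = D := fun h => legDim_mid h
  simp only [List.flatMap_range_add_two, legDim_first, legDim_last, siteTile_edge (Or.inl rfl),
    siteTile_edge (Or.inr rfl), zero_add, mid (Nat.succ_pos _), mid (Nat.lt_succ_self _),
    List.append_assoc]
  congr 1
  rw [List.flatMap_range_length row (f := fun x =>
    PEPS.siteWord 1 M.bondDim M.bondDim M.bondDim (FixedTile (M.startCode x)))]
  · congr 2
    rw [List.flatMap_range_const N _ (PEPS.siteWord M.bondDim M.bondDim 1 M.bondDim (FixedTile 0) ++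
      ((row.flatMap fun _ => PEPS.siteWord M.bondDim M.bondDim M.bondDim M.bondDim M.BulkTile) ++
      PEPS.siteWord M.bondDim M.bondDim M.bondDim 1 (FixedTile 0)))]
    · congr 2
      rw [List.flatMap_range_length row]
      intro i x hx
      have hi := (List.getElem?_eq_some_iff.1 hx).1
      rw [mid (by omega), mid (by omega), siteTile_bottom hi]
    · intro k hk
      rw [mid (by omega), mid (by omega), List.flatMap_range_length row]
      intro i x hx
      have hi := (List.getElem?_eq_some_iff.1 hx).1
      rw [mid (by omega), mid (by omega), siteTile_bulk hi hk]
  · intro i x hx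
    have hi := (List.getElem?_eq_some_iff.1 hx).1
    rw [mid (by omega), mid (by omega), siteTile_top hx]

end NTM

/-! ### Timed runs of stack machines -/

open Computability

namespace Turing.TM2

variable {K : Type*} [DecidableEq K] {Γ : K → Type*} {Λ σ : Type*}

/-- The machine comes from `c` to `c'` in at most `n` steps. -/
def RunsIn (m : Λ → Stmt Γ Λ σ) (n : ℕ) (c c' : Cfg Γ Λ σ) : Prop :=
  ∃ j ≤ n, (flip bind (step m))^[j] (some c) = some c'

variable {m : Λ → Stmt Γ Λ σ} {c c' c'' : Cfg Γ Λ σ} {n n' : ℕ}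

theorem RunsIn.trans (h : RunsIn m n c c') (h' : RunsIn m n' c' c'') : RunsIn m (n + n') c c'' := by
  obtain ⟨j, hj, e⟩ := h
  obtain ⟨j', hj', e'⟩ := h'
  exact ⟨j' + j, by omega, by rw [Function.iterate_add_apply, e, e']⟩

theorem RunsIn.mono (h : RunsIn m n c c') (hn : n ≤ n') : RunsIn m n' c c' := by
  obtain ⟨j, hj, e⟩ := h
  exact ⟨j, hj.trans hn, e⟩

theorem RunsIn.single (h : step m c = some c') : RunsIn m 1 c c' :=
  ⟨1, le_rfl, h⟩

theorem RunsIn.cons (h : step m c = some c') (h' : RunsIn m n c' c'') : RunsIn m (n + 1) c c'' :=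
  ((RunsIn.single h).trans h').mono (by omega)

/-- Push a word onto a stack, beginning with its last symbol. -/
def pushWord (k : K) : List (Γ k) → Stmt Γ Λ σ → Stmt Γ Λ σ
  | [], q => q
  | a :: l, q => pushWord k l (.push k (fun _ => a) q)

theorem stepAux_pushWord (k : K) (l : List (Γ k)) (q : Stmt Γ Λ σ) (v : σ)
    (S : ∀ k, List (Γ k)) :
    stepAux (pushWord k l q) v S = stepAux q v (Function.update S k (l ++ S k)) := by
  induction l generalizing q with
  | nil => simp [pushWord]
  | cons a l ih => simp [pushWord, ih]

open Classical in
/-- Continue as `f v` says, where `v` is the internal state, as long as `v` occurs in the list. -/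
noncomputable def dispatch (f : σ → Stmt Γ Λ σ) : List σ → Stmt Γ Λ σ
  | [] => .halt
  | s :: l => .branch (fun v => decide (v = s)) (f s) (dispatch f l)

/-- `pushWord` pushes a word fixed in the program; for a word that depends on the internal state,
the finitely many states are tried in turn, still within one step. -/
theorem stepAux_dispatch (f : σ → Stmt Γ Λ σ) {l : List σ} {v : σ} (hv : v ∈ l)
    (S : ∀ k, List (Γ k)) : stepAux (dispatch f l) v S = stepAux (f v) v S := by
  induction l with
  | nil => simp at hv
  | cons s l ih =>
    by_cases h : v = s
    · subst h
      simp [dispatch]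
    · simp [dispatch, h, ih (List.mem_of_ne_of_mem h hv)]

end Turing.TM2

/-! ### The printing machine -/

namespace PEPSLayout

open Turing TM2

/-- The store of the printing machine. -/
inductive Stack where
  | input
  | row
  | aux
  | num
  | count
  | out
  deriving DecidableEq

instance : Fintype Stack where
  elems := {.input, .row, .aux, .num, .count, .out}
  complete s := by cases s <;> decide

/-- The labels of the printing machine. -/
inductive Label (k : ℕ) where
  | start
  | load
  | mulOuter (i : Fin (k + 1))
  | mulInner (i : Fin (k + 1))
  | mulRestore (i : Fin (k + 1))
  | mulBack (i : Fin (k + 1))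
  | padLeft
  | unload
  | padRight
  | write (b : Bool)
  | nextRow
  | restore
  | writeTop
  | countColumns
  | countRows
  deriving Fintype

/-- The alphabets of the stacks. -/
abbrev StackSymbol (α : Type) : Stack → Type
  | .input => α
  | .row => Option α × Bool
  | .aux => Option α × Bool
  | .num => Unit
  | .count => Unit
  | .out => Γ'

/-- The internal state: the symbol popped last, or `none` if the stack was empty. -/
abbrev Register (α : Type) : Type :=
  Option (Option α × Bool)

/-- A blank cell. -/
abbrev blankCell (α : Type) : Option α × Bool :=
  (none, false)

section machine

variable {α : Type} (W : PEPSLayout (Option α × Bool)) (k c : ℕ)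

/-- Statements of the printing machine. -/
abbrev PStmt (α : Type) (k : ℕ) : Type :=
  Stmt (StackSymbol α) (Label k) (Register α)

/-- Pop an input letter and branch. -/
def popInput (q q' : PStmt α k) : PStmt α k :=
  .pop .input (fun _ o => o.map fun a => (some a, false)) (.branch Option.isSome q q')

/-- Pop a cell from a stack and branch. -/
def popRow (q q' : PStmt α k) : PStmt α k :=
  .pop .row (fun _ o => o) (.branch Option.isSome q q')

/-- Pop a cell from the auxiliary stack and branch. -/
def popAux (q q' : PStmt α k) : PStmt α k :=
  .pop .aux (fun _ o => o) (.branch Option.isSome q q')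

/-- Decrement the number and branch. -/
def popNum (q q' : PStmt α k) : PStmt α k :=
  .pop .num (fun _ o => o.map fun _ => blankCell α) (.branch Option.isSome q q')

/-- Decrement the counter and branch. -/
def popCount (q q' : PStmt α k) : PStmt α k :=
  .pop .count (fun _ o => o.map fun _ => blankCell α) (.branch Option.isSome q q')

/-- Push the cell popped last. -/
def pushRow (q : PStmt α k) : PStmt α k :=
  .push .row (fun v => v.getD (blankCell α)) q

/-- Push the cell popped last onto the auxiliary stack. -/
def pushAux (q : PStmt α k) : PStmt α k :=
  .push .aux (fun v => v.getD (blankCell α)) q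

/-- Push a blank cell. -/
def pushBlank (q : PStmt α k) : PStmt α k :=
  .push .row (fun _ => blankCell α) q

/-- Increment the number. -/
def pushNum (q : PStmt α k) : PStmt α k :=
  .push .num (fun _ => ()) q

/-- Increment the counter. -/
def pushCount (q : PStmt α k) : PStmt α k :=
  .push .count (fun _ => ()) q

/-- Print a word. -/
def print (l : List Γ') (q : PStmt α k) : PStmt α k :=
  pushWord (Γ := StackSymbol α) .out l q

/-- Jump to a label. -/
def jump (l : Label k) : PStmt α k :=
  .goto fun _ => l

/-- The program that prints the description, from its end to its beginning. -/
noncomputable def program [Fintype α] : Label k → PStmt α k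
  | .start =>
    .pop .input (fun _ o => o.map fun a => (some a, false)) <|
      .push .aux (fun v => (v.bind Prod.fst, true)) <|
        pushWord (Γ := StackSymbol α) .num (List.replicate c ()) (jump k .load)
  | .load => popInput k (pushAux k (jump k .load)) (jump k (.mulOuter (Fin.last k)))
  | .mulOuter i =>
    if i.val = 0 then jump k .padLeft
    else popNum k (jump k (.mulInner i)) (jump k (.mulBack i))
  | .mulInner i => popAux k (pushRow k (pushCount k (jump k (.mulInner i))))
      (jump k (.mulRestore i))
  | .mulRestore i => popRow k (pushAux k (jump k (.mulRestore i))) (jump k (.mulOuter i))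
  | .mulBack i => popCount k (pushNum k (jump k (.mulBack i)))
      (jump k (.mulOuter ⟨i.val - 1, by omega⟩))
  | .padLeft => popNum k (pushCount k (pushBlank k (jump k .padLeft))) (jump k .unload)
  | .unload => popAux k (pushRow k (jump k .unload)) (jump k .padRight)
  | .padRight => popCount k (pushNum k (pushBlank k (jump k .padRight)))
      (print k W.bottomRight (jump k (.write false)))
  | .write b => popRow k (pushAux k (print k (if b then W.bulk else W.bottom) (jump k (.write b))))
      (print k (if b then W.left else W.bottomLeft) (jump k .nextRow))
  | .nextRow => popNum k (pushCount k (print k W.right (jump k .restore)))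
      (print k W.topRight (jump k .writeTop))
  | .restore => popAux k (pushRow k (jump k .restore)) (jump k (.write true))
  | .writeTop => popAux k
      (pushRow k (dispatch (fun v => print k (W.top (v.getD (blankCell α))) (jump k .writeTop))
        Finset.univ.toList))
      (print k ([Γ'.bit true, Γ'.bit true, Γ'.comma] ++ (W.header ++ W.topLeft))
        (jump k .countColumns))
  | .countColumns => popRow k (print k [Γ'.bit true] (jump k .countColumns))
      (print k [Γ'.bit true, Γ'.bit true, Γ'.comma] (jump k .countRows))
  | .countRows => popCount k (print k [Γ'.bit true] (jump k .countRows)) .halt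

/-- The contents of all the stacks. -/
def store (i : List α) (r a : List (Option α × Bool)) (n t : ℕ) (o : List Γ') :
    ∀ s, List (StackSymbol α s)
  | .input => i
  | .row => r
  | .aux => a
  | .num => List.replicate n ()
  | .count => List.replicate t ()
  | .out => o

/-- A configuration of the printing machine. -/
def cfg (l : Option (Label k)) (v : Register α) (i : List α) (r a : List (Option α × Bool))
    (n t : ℕ) (o : List Γ') : Cfg (StackSymbol α) (Label k) (Register α) :=
  ⟨l, v, store i r a n t o⟩

section update

variable (i i' : List α) (r r' a a' : List (Option α × Bool)) (n n' t t' : ℕ) (o o' : List Γ')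

theorem update_input : Function.update (store i r a n t o) .input i' = store i' r a n t o := by
  funext s; cases s <;> rfl

theorem update_row : Function.update (store i r a n t o) .row r' = store i r' a n t o := by
  funext s; cases s <;> rfl

theorem update_aux : Function.update (store i r a n t o) .aux a' = store i r a' n t o := by
  funext s; cases s <;> rfl

theorem update_num : Function.update (store i r a n t o) .num (List.replicate n' ()) =
    store i r a n' t o := by
  funext s; cases s <;> rfl

theorem update_count : Function.update (store i r a n t o) .count (List.replicate t' ()) =
    store i r a n t' o := by
  funext s; cases s <;> rfl

theorem update_out : Function.update (store i r a n t o) .out o' = store i r a n t o' := by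
  funext s; cases s <;> rfl

end update

section stmts

variable {k}
variable (q q' : PStmt α k) (v : Register α) (i : List α) (r a : List (Option α × Bool)) (n t : ℕ)
  (o : List Γ')

theorem stepAux_popInput_cons (x : α) : stepAux (popInput k q q') v (store (x :: i) r a n t o) =
    stepAux q (some (some x, false)) (store i r a n t o) := by
  rw [popInput, stepAux, update_input]; rfl

theorem stepAux_popInput_nil : stepAux (popInput k q q') v (store [] r a n t o) =
    stepAux q' none (store [] r a n t o) := by
  rw [popInput, stepAux, update_input]; rfl

theorem stepAux_popRow_cons (x) : stepAux (popRow k q q') v (store i (x :: r) a n t o) =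
    stepAux q (some x) (store i r a n t o) := by
  rw [popRow, stepAux, update_row]; rfl

theorem stepAux_popRow_nil : stepAux (popRow k q q') v (store i [] a n t o) =
    stepAux q' none (store i [] a n t o) := by
  rw [popRow, stepAux, update_row]; rfl

theorem stepAux_popAux_cons (x) : stepAux (popAux k q q') v (store i r (x :: a) n t o) =
    stepAux q (some x) (store i r a n t o) := by
  rw [popAux, stepAux, update_aux]; rfl

theorem stepAux_popAux_nil : stepAux (popAux k q q') v (store i r [] n t o) =
    stepAux q' none (store i r [] n t o) := by
  rw [popAux, stepAux, update_aux]; rfl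

theorem stepAux_popNum_succ : stepAux (popNum k q q') v (store i r a (n + 1) t o) =
    stepAux q (some (blankCell α)) (store i r a n t o) := by
  rw [popNum, stepAux]
  exact congrArg (stepAux q _) (update_num ..)

theorem stepAux_popNum_zero : stepAux (popNum k q q') v (store i r a 0 t o) =
    stepAux q' none (store i r a 0 t o) := by
  rw [popNum, stepAux]
  exact congrArg (stepAux q' _) (update_num (n' := 0) ..)

theorem stepAux_popCount_succ : stepAux (popCount k q q') v (store i r a n (t + 1) o) =
    stepAux q (some (blankCell α)) (store i r a n t o) := by
  rw [popCount, stepAux]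
  exact congrArg (stepAux q _) (update_count ..)

theorem stepAux_popCount_zero : stepAux (popCount k q q') v (store i r a n 0 o) =
    stepAux q' none (store i r a n 0 o) := by
  rw [popCount, stepAux]
  exact congrArg (stepAux q' _) (update_count (t' := 0) ..)

theorem stepAux_pushRow (x) : stepAux (pushRow k q) (some x) (store i r a n t o) =
    stepAux q (some x) (store i (x :: r) a n t o) := by
  rw [pushRow, stepAux, update_row]; rfl

theorem stepAux_pushAux (x) : stepAux (pushAux k q) (some x) (store i r a n t o) =
    stepAux q (some x) (store i r (x :: a) n t o) := by
  rw [pushAux, stepAux, update_aux]; rfl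

theorem stepAux_pushBlank : stepAux (pushBlank k q) v (store i r a n t o) =
    stepAux q v (store i (blankCell α :: r) a n t o) := by
  rw [pushBlank, stepAux, update_row]; rfl

theorem stepAux_pushNum : stepAux (pushNum k q) v (store i r a n t o) =
    stepAux q v (store i r a (n + 1) t o) := by
  rw [pushNum, stepAux]
  exact congrArg (stepAux q _) (update_num (n' := n + 1) ..)

theorem stepAux_pushCount : stepAux (pushCount k q) v (store i r a n t o) =
    stepAux q v (store i r a n (t + 1) o) := by
  rw [pushCount, stepAux]
  exact congrArg (stepAux q _) (update_count (t' := t + 1) ..)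

theorem stepAux_print (l : List Γ') : stepAux (print k l q) v (store i r a n t o) =
    stepAux q v (store i r a n t (l ++ o)) := by
  rw [print, stepAux_pushWord, update_out]; rfl

theorem stepAux_jump (l : Label k) : stepAux (jump k l) v (store i r a n t o) =
    cfg k (some l) v i r a n t o :=
  rfl

theorem stepAux_pushNums (d : ℕ) :
    stepAux (pushWord (Γ := StackSymbol α) .num (List.replicate d ()) q) v (store i r a n t o) =
      stepAux q v (store i r a (d + n) t o) := by
  rw [stepAux_pushWord]
  have e : List.replicate d () ++ store i r a n t o .num = List.replicate (d + n) () :=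
    List.replicate_append_replicate
  exact congrArg (stepAux q v) ((congrArg (Function.update (store i r a n t o) Stack.num) e).trans
    (update_num ..))

end stmts

end machine

end PEPSLayout

/-! ### Runs of the loops of the printing machine -/

open Computability

namespace PEPSLayout

open Turing TM2

section runs

variable {α : Type} [Fintype α] (W : PEPSLayout (Option α × Bool)) (k c : ℕ)

theorem step_cfg (l : Label k) (v : Register α) (i : List α) (r a : List (Option α × Bool))
    (n t : ℕ) (o : List Γ') : step (program W k c) (cfg k (some l) v i r a n t o) =
      some (stepAux (program W k c l) v (store i r a n t o)) :=
  rfl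

variable {W k c} {v : Register α} {i : List α} {r a : List (Option α × Bool)} {n t : ℕ}
  {o : List Γ'}

theorem run_load : RunsIn (program W k c) (i.length + 1) (cfg k (some .load) v i r a n t o)
    (cfg k (some (.mulOuter (Fin.last k))) none [] r
      ((i.map fun x => (some x, false)).reverse ++ a) n t o) := by
  induction i generalizing v a with
  | nil =>
    refine .single ?_
    simp only [step_cfg, program, stepAux_popInput_nil, stepAux_jump, List.map_nil,
      List.reverse_nil, List.nil_append]
  | cons x i ih =>
    refine .cons (c' := cfg k (some .load) (some (some x, false)) i r ((some x, false) :: a) n t o)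
      ?_ (by simpa using ih)
    simp only [step_cfg, program, stepAux_popInput_cons, stepAux_pushAux, stepAux_jump]

theorem run_start : RunsIn (program W k c) (i.length + 2) (cfg k (some .start) v i [] [] 0 0 [])
    (cfg k (some (.mulOuter (Fin.last k))) none [] []
      ((i.head?, true) :: i.tail.map fun x => (some x, false)).reverse c 0 []) := by
  have h : step (program W k c) (cfg k (some .start) v i [] [] 0 0 []) =
      some (cfg k (some .load) (i.head?.map fun a => (some a, false)) i.tail [] [(i.head?, true)]
        c 0 []) := by
    rw [step_cfg, program, stepAux, update_input, stepAux, update_aux, stepAux_pushNums]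
    cases i <;> rfl
  have h' := RunsIn.cons h run_load
  rw [← List.reverse_cons] at h'
  exact h'.mono (by simp)

theorem run_mulInner {s : Fin (k + 1)} : RunsIn (program W k c) (a.length + 1)
    (cfg k (some (.mulInner s)) v i r a n t o)
    (cfg k (some (.mulRestore s)) none i (a.reverse ++ r) [] n (t + a.length) o) := by
  induction a generalizing v r t with
  | nil =>
    refine .single ?_
    simp only [step_cfg, program, stepAux_popAux_nil, stepAux_jump]
    rfl
  | cons x a ih =>
    refine .cons (c' := cfg k (some (.mulInner s)) (some x) i (x :: r) a n (t + 1) o)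
      ?_ (by
        rw [List.reverse_cons, List.append_assoc, show t + (x :: a).length = t + 1 + a.length by
          rw [List.length_cons]; omega]
        exact ih)
    simp only [step_cfg, program, stepAux_popAux_cons, stepAux_pushRow, stepAux_pushCount,
      stepAux_jump]

theorem run_mulRestore {s : Fin (k + 1)} : RunsIn (program W k c) (r.length + 1)
    (cfg k (some (.mulRestore s)) v i r a n t o)
    (cfg k (some (.mulOuter s)) none i [] (r.reverse ++ a) n t o) := by
  induction r generalizing v a with
  | nil =>
    refine .single ?_
    simp only [step_cfg, program, stepAux_popRow_nil, stepAux_jump]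
    rfl
  | cons x r ih =>
    refine .cons (c' := cfg k (some (.mulRestore s)) (some x) i r (x :: a) n t o)
      ?_ (by simpa using ih)
    simp only [step_cfg, program, stepAux_popRow_cons, stepAux_pushAux, stepAux_jump]

/-- Multiplication by repeated addition: each unit of the number adds the length of the auxiliary
stack to the counter, by moving that stack to the row stack and back. -/
theorem run_mulOuter {s : Fin (k + 1)} (hs : s.val ≠ 0) :
    RunsIn (program W k c) (n * (2 * a.length + 3) + 1)
    (cfg k (some (.mulOuter s)) v i [] a n t o)
    (cfg k (some (.mulBack s)) none i [] a 0 (t + n * a.length) o) := by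
  induction n generalizing v t with
  | zero =>
    refine (RunsIn.single ?_).mono (by omega)
    simp only [step_cfg, program, if_neg hs, stepAux_popNum_zero, stepAux_jump]
    simp
  | succ n ih =>
    have h : step (program W k c) (cfg k (some (.mulOuter s)) v i [] a (n + 1) t o) =
        some (cfg k (some (.mulInner s)) (some (blankCell α)) i [] a n t o) := by
      simp only [step_cfg, program, if_neg hs, stepAux_popNum_succ, stepAux_jump]
    have h1 := RunsIn.cons h (run_mulInner.trans run_mulRestore)
    simp only [List.append_nil, List.reverse_reverse, List.length_reverse] at h1
    have h2 := h1.trans ih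
    rw [show t + (n + 1) * a.length = t + a.length + n * a.length by ring]
    exact h2.mono (le_of_eq (by ring))

theorem run_mulBack {s : Fin (k + 1)} : RunsIn (program W k c) (t + 1)
    (cfg k (some (.mulBack s)) v i r a n t o)
    (cfg k (some (.mulOuter ⟨s.val - 1, by omega⟩)) none i r a (n + t) 0 o) := by
  induction t generalizing v n with
  | zero =>
    refine .single ?_
    simp only [step_cfg, program, stepAux_popCount_zero, stepAux_jump]
    rfl
  | succ t ih =>
    refine .cons (c' := cfg k (some (.mulBack s)) (some (blankCell α)) i r a (n + 1) t o)
      ?_ (by simpa [add_comm, add_left_comm] using ih)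
    simp only [step_cfg, program, stepAux_popCount_succ, stepAux_pushNum, stepAux_jump]

/-- The label index counts the multiplications still to be done. Since `a` is non-empty the number
never decreases, so each round is charged at the final value. -/
theorem run_power {s : Fin (k + 1)} (ha : a ≠ []) : RunsIn (program W k c)
    (s.val * (n * a.length ^ s.val * (3 * a.length + 3) + 2) + 1)
    (cfg k (some (.mulOuter s)) none i [] a n 0 o)
    (cfg k (some .padLeft) none i [] a (n * a.length ^ s.val) 0 o) := by
  obtain ⟨s, hs⟩ := s
  have ha' : 1 ≤ a.length := List.length_pos_iff.2 ha
  induction s generalizing n with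
  | zero =>
    refine (RunsIn.single ?_).mono (by omega)
    simp only [step_cfg, program, if_true, stepAux_jump]
    simp
  | succ s ih =>
    have h1 := (run_mulOuter (W := W) (c := c) (v := none) (i := i) (a := a) (n := n) (t := 0) (o := o)
      (s := ⟨s + 1, hs⟩) (Nat.succ_ne_zero s)).trans run_mulBack
    simp only [zero_add, Nat.add_sub_cancel] at h1
    have h2 := h1.trans (ih (n := n * a.length) (by omega))
    have e : n * a.length * a.length ^ s = n * a.length ^ (s + 1) := by ring
    rw [e] at h2
    refine h2.mono ?_
    -- The current value and the next one are both at most the final value `P`; a round then costs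
    -- at most `P * (2 * a.length + 4) + 2`, and `1 ≤ a.length` absorbs the constant.
    have h3 : n * 1 ≤ n * a.length ^ (s + 1) :=
      Nat.mul_le_mul_left n (Nat.one_le_pow _ _ ha')
    have h4 : n * a.length ≤ n * a.length ^ (s + 1) :=
      Nat.mul_le_mul_left n (le_self_pow₀ ha' (Nat.succ_ne_zero s))
    dsimp only
    generalize n * a.length ^ (s + 1) = P at *
    have h5 : n * (2 * a.length + 3) ≤ P * (2 * a.length + 3) :=
      Nat.mul_le_mul_right _ (by omega)
    nlinarith

/-- The number is moved to the counter rather than erased, because it is needed again for the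
padding on the other side and for the rows. -/
theorem run_padLeft : RunsIn (program W k c) (n + 1)
    (cfg k (some .padLeft) v i r a n t o)
    (cfg k (some .unload) none i (List.replicate n (blankCell α) ++ r) a 0 (t + n) o) := by
  induction n generalizing v r t with
  | zero =>
    refine .single ?_
    simp only [step_cfg, program, stepAux_popNum_zero, stepAux_jump]
    rfl
  | succ n ih =>
    refine .cons (c' := cfg k (some .padLeft) (some (blankCell α)) i (blankCell α :: r) a n (t + 1) o)
      ?_ (by
        rw [List.replicate_succ', List.append_assoc, ← add_assoc, add_right_comm]
        exact ih)
    simp only [step_cfg, program, stepAux_popNum_succ, stepAux_pushCount, stepAux_pushBlank,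
      stepAux_jump]

theorem run_unload : RunsIn (program W k c) (a.length + 1)
    (cfg k (some .unload) v i r a n t o)
    (cfg k (some .padRight) none i (a.reverse ++ r) [] n t o) := by
  induction a generalizing v r with
  | nil =>
    refine .single ?_
    simp only [step_cfg, program, stepAux_popAux_nil, stepAux_jump]
    rfl
  | cons x a ih =>
    refine .cons (c' := cfg k (some .unload) (some x) i (x :: r) a n t o)
      ?_ (by simpa using ih)
    simp only [step_cfg, program, stepAux_popAux_cons, stepAux_pushRow, stepAux_jump]

theorem run_padRight : RunsIn (program W k c) (t + 1)
    (cfg k (some .padRight) v i r a n t o)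
    (cfg k (some (.write false)) none i (List.replicate t (blankCell α) ++ r) a (n + t) 0
      (W.bottomRight ++ o)) := by
  induction t generalizing v r n with
  | zero =>
    refine .single ?_
    simp only [step_cfg, program, stepAux_popCount_zero, stepAux_print, stepAux_jump]
    rfl
  | succ t ih =>
    refine .cons (c' := cfg k (some .padRight) (some (blankCell α)) i (blankCell α :: r) a (n + 1) t o)
      ?_ (by
        rw [List.replicate_succ', List.append_assoc, ← add_assoc, add_right_comm]
        exact ih)
    simp only [step_cfg, program, stepAux_popCount_succ, stepAux_pushNum, stepAux_pushBlank,
      stepAux_jump]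

theorem flatMap_const_append_append {β γ : Type} (l : List β) (w o : List γ) :
    (l.flatMap fun _ => w) ++ (w ++ o) = w ++ ((l.flatMap fun _ => w) ++ o) := by
  induction l with
  | nil => rfl
  | cons x l ih => simp [List.append_assoc, ih]

/-- Output grows at its front while the row is scanned from its first cell; the mismatch is harmless
because these words ignore the cell (`flatMap_const_append_append`). -/
theorem run_write {b : Bool} : RunsIn (program W k c) (r.length + 1)
    (cfg k (some (.write b)) v i r a n t o)
    (cfg k (some .nextRow) none i [] (r.reverse ++ a) n t
      ((if b then W.left else W.bottomLeft) ++
        ((r.flatMap fun _ => if b then W.bulk else W.bottom) ++ o))) := by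
  induction r generalizing v a o with
  | nil =>
    refine .single ?_
    simp only [step_cfg, program, stepAux_popRow_nil, stepAux_print, stepAux_jump]
    rfl
  | cons x r ih =>
    refine .cons (c' := cfg k (some (.write b)) (some x) i r (x :: a) n t
      ((if b then W.bulk else W.bottom) ++ o)) ?_ ?_
    · simp only [step_cfg, program, stepAux_popRow_cons, stepAux_pushAux, stepAux_print,
        stepAux_jump]
    · rw [List.reverse_cons, List.append_assoc, List.flatMap_cons, List.append_assoc _ _ o,
        ← flatMap_const_append_append]
      exact ih

theorem run_restore : RunsIn (program W k c) (a.length + 1)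
    (cfg k (some .restore) v i r a n t o)
    (cfg k (some (.write true)) none i (a.reverse ++ r) [] n t o) := by
  induction a generalizing v r with
  | nil =>
    refine .single ?_
    simp only [step_cfg, program, stepAux_popAux_nil, stepAux_jump]
    rfl
  | cons x a ih =>
    refine .cons (c' := cfg k (some .restore) (some x) i (x :: r) a n t o)
      ?_ (by simpa using ih)
    simp only [step_cfg, program, stepAux_popAux_cons, stepAux_pushRow, stepAux_jump]

/-- The number counts the interior rows still to be printed and the counter those already printed,
so that `N` survives for the unary size at the front. -/
theorem run_nextRow : RunsIn (program W k c) (n * (2 * r.length + 3) + 1)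
    (cfg k (some .nextRow) v i [] r.reverse n t o)
    (cfg k (some .writeTop) none i [] r.reverse 0 (t + n)
      (W.topRight ++ ((List.replicate n (W.bulkRow r)).flatten ++ o))) := by
  induction n generalizing v t o with
  | zero =>
    refine (RunsIn.single ?_).mono (by omega)
    simp only [step_cfg, program, stepAux_popNum_zero, stepAux_print, stepAux_jump]
    rfl
  | succ n ih =>
    have h : step (program W k c) (cfg k (some .nextRow) v i [] r.reverse (n + 1) t o) =
        some (cfg k (some .restore) (some (blankCell α)) i [] r.reverse n (t + 1)
          (W.right ++ o)) := by
      simp only [step_cfg, program, stepAux_popNum_succ, stepAux_pushCount, stepAux_print,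
        stepAux_jump]
    have h1 := RunsIn.cons h (run_restore.trans run_write)
    simp only [List.append_nil, List.reverse_reverse, List.length_reverse, if_true] at h1
    have h2 := h1.trans ih
    rw [List.replicate_succ', List.flatten_append, show t + (n + 1) = t + 1 + n by ring]
    simp only [List.flatten_cons, List.flatten_nil, List.append_nil, List.append_assoc, bulkRow]
    simp only [bulkRow] at h2
    exact h2.mono (le_of_eq (by ring))

/-- Here the order of the cells matters. The auxiliary stack holds the row reversed, so its last
cell is printed first, as an output growing at its front requires. -/
theorem run_writeTop : RunsIn (program W k c) (a.length + 1)
    (cfg k (some .writeTop) v i r a n t o)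
    (cfg k (some .countColumns) none i (a.reverse ++ r) [] n t
      ([Γ'.bit true, Γ'.bit true, Γ'.comma] ++ (W.header ++ (W.topLeft ++
        (a.reverse.flatMap W.top ++ o))))) := by
  induction a generalizing v r o with
  | nil =>
    refine .single ?_
    simp only [step_cfg, program, stepAux_popAux_nil, stepAux_print, stepAux_jump]
    simp
  | cons x a ih =>
    refine .cons (c' := cfg k (some .writeTop) (some x) i (x :: r) a n t (W.top x ++ o))
      ?_ (by simpa using ih)
    simp only [step_cfg, program, stepAux_popAux_cons, stepAux_pushRow]
    rw [stepAux_dispatch _ (Finset.mem_toList.2 (Finset.mem_univ _)), stepAux_print, stepAux_jump]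
    rfl

theorem replicate_append_cons {β : Type} (n : ℕ) (x : β) (o : List β) :
    List.replicate n x ++ x :: o = List.replicate (n + 1) x ++ o := by
  rw [List.replicate_succ', List.append_assoc]
  rfl

theorem run_countColumns : RunsIn (program W k c) (r.length + 1)
    (cfg k (some .countColumns) v i r a n t o)
    (cfg k (some .countRows) none i [] a n t
      ([Γ'.bit true, Γ'.bit true, Γ'.comma] ++
        (List.replicate r.length (Γ'.bit true) ++ o))) := by
  induction r generalizing v o with
  | nil =>
    refine .single ?_
    simp only [step_cfg, program, stepAux_popRow_nil, stepAux_print, stepAux_jump]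
    simp
  | cons x r ih =>
    refine .cons (c' := cfg k (some .countColumns) (some x) i r a n t (Γ'.bit true :: o)) ?_ ?_
    · simp only [step_cfg, program, stepAux_popRow_cons, stepAux_print, stepAux_jump]
      rfl
    · rw [List.length_cons, ← replicate_append_cons]
      exact ih

theorem run_countRows : RunsIn (program W k c) (t + 1)
    (cfg k (some .countRows) v i r a n t o)
    (cfg k none none i r a n 0 (List.replicate t (Γ'.bit true) ++ o)) := by
  induction t generalizing v o with
  | zero =>
    refine .single ?_
    simp only [step_cfg, program, stepAux_popCount_zero]
    rfl
  | succ t ih =>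
    refine .cons (c' := cfg k (some .countRows) (some (blankCell α)) i r a n t (Γ'.bit true :: o))
      ?_ ?_
    · simp only [step_cfg, program, stepAux_popCount_succ, stepAux_print, stepAux_jump]
      rfl
    · rw [← replicate_append_cons]
      exact ih

end runs

end PEPSLayout

/-! ### Total running time and the reduction -/

open Computability

namespace PEPSLayout

open Turing TM2

/-- A bound for the running time of the printing machine on an input of length `L`, when it prints
the description of a diagram of `N` steps. -/
def printTime (k N L : ℕ) : ℕ :=
  (L + 2) + (k * (N * (3 * (L + 1) + 3) + 2) + 1) + (N + 1) + (L + 2) + (N + 1) +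
    (2 * N + L + 2) + (N * (2 * (2 * N + L + 1) + 3) + 1) + (2 * N + L + 2) + (2 * N + L + 2) +
    (N + 1)

theorem printTime_mono {k N N' L : ℕ} (h : N ≤ N') : printTime k N L ≤ printTime k N' L := by
  unfold printTime
  gcongr

section

variable {α : Type} [Fintype α] (W : PEPSLayout (Option α × Bool)) (k c : ℕ)

theorem run_program {w : List α} {N : ℕ} (hN : N = c * (w.length - 1 + 1) ^ k) :
    RunsIn (program W k c) (printTime k N w.length) (cfg k (some .start) none w [] [] 0 0 [])
      (cfg k none none [] [] [] 0 0 (W.word N (NTM.inputRow N w))) := by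
  set x : List (Option α × Bool) := (w.head?, true) :: w.tail.map fun a => (some a, false) with hx
  have hxl : x.reverse.length = w.length - 1 + 1 := by simp [hx]
  have h1 := (run_start (W := W) (k := k) (c := c) (v := none) (i := w)).trans
    (run_power (s := Fin.last k) (by simp))
  rw [← hx, Fin.val_last, hxl, ← hN] at h1
  have h2 := ((h1.trans run_padLeft).trans run_unload).trans run_padRight
  rw [List.reverse_reverse, List.append_nil, zero_add, ← List.append_assoc] at h2
  have hrow : List.replicate N (blankCell α) ++ x ++ List.replicate N (blankCell α) =
      NTM.inputRow N w := by
    simp [NTM.inputRow, hx]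
  have hlen := NTM.length_inputRow N w
  rw [hrow, zero_add] at h2
  have h3 := (h2.trans run_write).trans (by rw [List.append_nil]; exact run_nextRow)
  have h4 := ((h3.trans run_writeTop).trans run_countColumns).trans run_countRows
  simp only [List.reverse_reverse, List.append_nil, zero_add, Bool.false_eq_true, if_false] at h4
  -- The two extra strokes before each comma account for the border rows and columns, in the sizes
  -- `N + 2` and `row.length + 2`.
  have e : List.replicate N (Γ'.bit true) ++ ([Γ'.bit true, Γ'.bit true, Γ'.comma] ++
      (List.replicate (NTM.inputRow N w).length (Γ'.bit true) ++
        ([Γ'.bit true, Γ'.bit true, Γ'.comma] ++ (W.header ++ (W.topLeft ++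
          ((NTM.inputRow N w).flatMap W.top ++ (W.topRight ++
            ((List.replicate N (W.bulkRow (NTM.inputRow N w))).flatten ++ (W.bottomLeft ++
              (((NTM.inputRow N w).flatMap fun _ => W.bottom) ++ W.bottomRight)))))))))) =
      W.word N (NTM.inputRow N w) := by
    simp [word, topRow, bottomRow, PEPS.encodeSize, List.replicate_succ']
  rw [e] at h4
  refine h4.mono ?_
  have b1 : k * (N * (3 * (w.length - 1 + 1) + 3) + 2) ≤ k * (N * (3 * (w.length + 1) + 3) + 2) := by
    gcongr
    omega
  have b2 : N * (2 * (NTM.inputRow N w).length + 3) ≤ N * (2 * (2 * N + w.length + 1) + 3) := by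
    gcongr
    omega
  rw [hxl, List.length_reverse (as := NTM.inputRow N w)]
  unfold printTime
  omega

/-- The machine that prints the description of a space-time diagram. -/
noncomputable def printer : FinTM2 where
  K := Stack
  k₀ := .input
  k₁ := .out
  Γ := StackSymbol α
  Λ := Label k
  main := .start
  σ := Register α
  initialState := none
  Γk₀Fin := inferInstanceAs (Fintype α)
  m := program W k c

theorem initList_printer (w : List α) :
    initList (printer W k c) w = cfg k (some .start) none w [] [] 0 0 [] := by
  refine congrArg (Cfg.mk _ _) (funext fun s => ?_)
  cases s <;> rfl

theorem haltList_printer (o : List Γ') :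
    haltList (printer W k c) o = cfg (α := α) k none none [] [] [] 0 0 o := by
  refine congrArg (Cfg.mk _ _) (funext fun s => ?_)
  cases s <;> rfl

end

end PEPSLayout

/-- Each monomial is at most `y ^ p.natDegree` times its coefficient, and the coefficients sum to
`p.eval 1`. This replaces an arbitrary time bound by one that the printer can compute. -/
theorem Polynomial.eval_le_mul_pow_natDegree (p : Polynomial ℕ) {x y : ℕ} (hxy : x ≤ y) (hy : 1 ≤ y) :
    p.eval x ≤ p.eval 1 * y ^ p.natDegree := by
  rw [Polynomial.eval_eq_sum_range, Polynomial.eval_eq_sum_range, Finset.sum_mul]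
  refine Finset.sum_le_sum fun i hi => ?_
  rw [one_pow, mul_one]
  exact Nat.mul_le_mul_left _ ((Nat.pow_le_pow_left hxy i).trans
    (Nat.pow_le_pow_right hy (by simpa [Nat.lt_succ_iff] using hi)))

open Polynomial in
theorem NTM.computable_tableauPEPS {α : Type} [Fintype α] (M : NTM α) (k c : ℕ) :
    Nonempty (Turing.TM2ComputableInPolyTime (id : List α → List α) PEPS.encode
      fun w => M.tableauPEPS (c * (w.length - 1 + 1) ^ k) w) := by
  let W := M.layout
  -- Truncated subtraction is not polynomial, so `w.length - 1 + 1` is bounded by `w.length + 1` in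
  -- the time bound.
  let N : Polynomial ℕ := C c * (X + 1) ^ k
  let T : Polynomial ℕ := (X + 2) + (C k * (N * (3 * (X + 1) + 3) + 2) + 1) + (N + 1) + (X + 2) +
    (N + 1) + (2 * N + X + 2) + (N * (2 * (2 * N + X + 1) + 3) + 1) + (2 * N + X + 2) +
    (2 * N + X + 2) + (N + 1)
  have hN : ∀ L, N.eval L = c * (L + 1) ^ k := fun L => by simp [N]
  have hT : ∀ L, T.eval L = PEPSLayout.printTime k (c * (L + 1) ^ k) L := fun L => by
    simp [T, hN, PEPSLayout.printTime]
  refine ⟨{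
    tm := W.printer k c
    inputAlphabet := Equiv.refl α
    outputAlphabet := Equiv.refl Γ'
    time := T
    outputsFun := fun w => Classical.choice ?_ }⟩
  have h := (W.run_program k c (w := w) rfl).mono (n' := T.eval w.length) (by
    rw [hT]
    exact PEPSLayout.printTime_mono (Nat.mul_le_mul_left _ (Nat.pow_le_pow_left (by omega) _)))
  obtain ⟨j, hj, e⟩ := h
  refine ⟨⟨⟨j, ?_⟩, hj⟩⟩
  have e₁ : List.map (Equiv.refl α).invFun (id w) = w := List.map_id w
  have e₂ : List.map (Equiv.refl Γ').invFun
      (M.tableauPEPS (c * (w.length - 1 + 1) ^ k) w).encode =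
        W.word (c * (w.length - 1 + 1) ^ k) (NTM.inputRow (c * (w.length - 1 + 1) ^ k) w) :=
    (List.map_id _).trans (NTM.tableauPEPS_encode _ _)
  refine Eq.trans ?_ (e.trans ?_)
  · exact congrArg (fun x => (flip bind (Turing.TM2.step (W.program k c)))^[j] (some x))
      ((congrArg (Turing.initList (W.printer k c)) e₁).trans (W.initList_printer k c w))
  · exact congrArg some ((congrArg (Turing.haltList (W.printer k c)) e₂).trans
      (W.haltList_printer k c _)).symm

/-- PEPS zero testing is NP-hard, already for PEPS that are translation invariant in the bulk. -/
theorem theorem3 :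
    IsNPHardOn PEPS.encode {P : PEPS | P.IsBulkHomogeneous} {P : PEPS | P.state ≠ 0} := by
  rintro α _ L ⟨M, hM, p, hp⟩
  cases nonempty_fintype α
  refine ⟨_, M.computable_tableauPEPS p.natDegree (p.eval 1), fun w =>
    ⟨M.tableauPEPS_isBulkHomogeneous _ w, ?_⟩⟩
  rw [Set.mem_ofPred_eq, NTM.tableauPEPS_state_ne_zero_iff]
  constructor
  · intro hw
    obtain ⟨t, ht, h⟩ := hp w hw
    refine ⟨t, ht.trans ?_, h⟩
    -- The base `w.length - 1 + 1` is `max(|w|, 1)`: it is positive even for the empty word.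
    exact p.eval_le_mul_pow_natDegree (by omega) (by omega)
  · rintro ⟨t, -, h⟩
    exact (hM w).2 ⟨t, h⟩
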